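/- Let $p,q\in\mathbb{R}\setminus\{0\}$ and let $P:\mathbb{R}\to\mathbb{R}$ be a Schwartz function of compact support. Notation. For $X\in\mathbb{R}$ put $D_XP(k)=\frac{P(k+X/2)-P(k-X/2)}{X}$ if $X\neq 0$ and $D_0P(k)=P'(k)$. Let $\mathbb{H}[u](\Omega)=\frac1\pi\int_{\mathbb{R}}\frac{u(t)}{\Omega-t}\,dt$, as an ordinary integral for $\Omega\in\mathbb{C}\setminus\mathbb{R}$ and as a principal value for $\Omega\in\mathbb{R}$, and let $\mathbb{S}[u](x)=\mathbb{H}[u](x)-i\,u(x)$ for $x\in\mathbb{R}$. Let $$h(X,t)=2q\,\sin(2\pi^2pX^2t)\,\check P(2\pi pXt),\quad \check P(y)=\int_{\mathbb{R}}e^{2\pi i yk}P(k)\,dk,\qquad \tilde h(X,\omega)=\int_0^\infty e^{-\omega t}h(X,t)\,dt .$$ $P$ is called stable if there is $\kappa>0$ with $\inf_{\operatorname{Re}\omega>0,\;X\in\mathbb{R}}|1-\tilde h(X,\omega)|\geq\kappa$. Let $\Gamma_X=\{\mathbb{S}[D_XP](t):t\in\mathbb{R}\}\cup\{0\}$, regarded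 as the closed curve $t\mapsto\mathbb{S}[D_XP](t)$, $t\in\mathbb{R}$, which starts and ends at its limit $0$ as $t\to\pm\infty$; a point $z\in\mathbb{C}\setminus\Gamma_X$ is enclosed by $\Gamma_X$ if the winding number of this curve around $z$ is non-zero. Let $\overset{\circ}{\Gamma}_X$ be the set of points enclosed by $\Gamma_X$, and let $\overline\Gamma$ be the closure of $\bigcup_{X\in\mathbb{R}}\overset{\circ}{\Gamma}_X$. Theorem. The principal values $\mathbb{H}[D_XP](t)$ exist for all $X,t\in\mathbb{R}$, and the following are equivalent: (A) $\inf_{\operatorname{Re}\omega>0,\;X\in\mathbb{R}}|1-\tilde h(X,\omega)|=0$, i.e. $P$ is not stable. (B) Either there exist $X_*\in\mathbb{R}$ and $\Omega_*\in\mathbb{C}\setminus\mathbb{R}$ such that $\mathbb{H}[D_{X_*}P](\Omega_*)=\mathbb{H}[D_{X_*}P](\overline{\Omega_*})=\frac{4\pi p}{q}$, or there exist $X_*,\Omega_*\in\mathbb{R}$ such that $\mathbb{H}[D_{X_*}P](\Omega_*)=\frac{4\pi p}{q}$ and $D_{X_*}P(\Omega_*)=0$. (C) $d(\overline\Gamma,4\pi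 p/q)=0$ (where $d(\emptyset,\cdot)=\infty$), i.e. $4\pi p/q\in\overline\Gamma$. Moreover, if $\mathbb{H}[D_XP](t_*)<\frac{4\pi p}{q}$ for all $X,t_*\in\mathbb{R}$ with $D_XP(t_*)=0$, then $P$ is stable. -/

import Mathlib

open Filter Topology MeasureTheory
open scoped SchwartzMap FourierTransform ComplexConjugate

noncomputable section

namespace Alber

/-- The divided difference `D_X P`. -/
def divDiff (P : ℝ → ℝ) (X : ℝ) (k : ℝ) : ℝ :=
  if X = 0 then deriv P k else (P (k + X / 2) - P (k - X / 2)) / X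

/-- The truncated integral `(1/π) ∫_{|x-t|>ε} u(t)/(x-t) dt` whose limit as `ε ↓ 0` is the
Hilbert transform. -/
def hilbertTrunc (u : ℝ → ℝ) (x ε : ℝ) : ℝ :=
  Real.pi⁻¹ * ∫ t in {t : ℝ | ε < |x - t|}, u t / (x - t)

/-- The Hilbert transform `H[u](x)` at a real point, as a principal value. -/
def hilbert (u : ℝ → ℝ) (x : ℝ) : ℝ :=
  limUnder (𝓝[>] 0) (hilbertTrunc u x)

/-- The Hilbert transform `H[u](Ω)` at a non-real point `Ω`, where the integral is an
ordinary (absolutely convergent) one. -/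
def hilbertOff (u : ℝ → ℝ) (Ω : ℂ) : ℂ :=
  (Real.pi : ℂ)⁻¹ * ∫ t : ℝ, (u t : ℂ) / (Ω - t)

/-- The signal transform `S[u] = H[u] - i u` on the real line. -/
def signal (u : ℝ → ℝ) (x : ℝ) : ℂ :=
  (hilbert u x : ℂ) - Complex.I * (u x : ℂ)

/-- The kernel `h(X,t) = 2q sin(2π²pX²t) P̌(2πpXt)`, where
`P̌(y) = ∫ e^{2πiyk} P(k) dk`. -/
def kernel (P : ℝ → ℝ) (p q X t : ℝ) : ℂ :=
  2 * (q : ℂ) * (Real.sin (2 * Real.pi ^ 2 * p * X ^ 2 * t) : ℂ) *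
    (𝓕⁻ (fun k : ℝ => (P k : ℂ))) (2 * Real.pi * p * X * t)

/-- The Laplace transform `h̃(X,ω) = ∫_0^∞ e^{-ωt} h(X,t) dt`. -/
def kernelLaplace (P : ℝ → ℝ) (p q X : ℝ) (ω : ℂ) : ℂ :=
  ∫ t in Set.Ioi (0 : ℝ), Complex.exp (-ω * t) * kernel P p q X t

/-- The infimum of `|1 - h̃(X,ω)|` over `X ∈ ℝ`, `Re ω > 0`. -/
def penroseInf (P : ℝ → ℝ) (p q : ℝ) : ℝ :=
  ⨅ z : ℝ × {ω : ℂ // 0 < ω.re}, ‖1 - kernelLaplace P p q z.1 z.2‖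

/-- The spectrum `P` is stable. -/
def IsStable (P : ℝ → ℝ) (p q : ℝ) : Prop :=
  ∃ κ : ℝ, 0 < κ ∧ κ ≤ penroseInf P p q

/-- The curve `Γ_X`, as a set: the values of `S[D_X P]` on the line, together with its limit `0`
at `±∞`. -/
def curveSet (P : ℝ → ℝ) (X : ℝ) : Set ℂ :=
  Set.range (signal (divDiff P X)) ∪ {0}

/-- The curve `γ : ℝ → ℂ`, closed up by its common limit at `±∞`, has winding number `n`
around `z`: there is a continuous branch `L` of `log (γ - z)` on the extended line, and it
increases by `2πin` from `-∞` to `+∞`. -/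
def HasWindingNumber (γ : ℝ → ℂ) (z : ℂ) (n : ℤ) : Prop :=
  ∃ L : ℝ → ℂ, Continuous L ∧ (∀ t, γ t - z = Complex.exp (L t)) ∧
    ∃ a : ℂ, Tendsto L atBot (𝓝 a) ∧ Tendsto L atTop (𝓝 (a + 2 * Real.pi * Complex.I * n))

/-- The points enclosed by `Γ_X`: the points off the curve around which it winds. -/
def enclosed (P : ℝ → ℝ) (X : ℝ) : Set ℂ :=
  {z | z ∉ curveSet P X ∧ ∃ n : ℤ, n ≠ 0 ∧ HasWindingNumber (signal (divDiff P X)) z n}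

/-- The closure of the union over all `X` of the regions enclosed by `Γ_X`. -/
def enclosedClosure (P : ℝ → ℝ) : Set ℂ :=
  closure (⋃ X : ℝ, enclosed P X)

end Alber

end

/-! Put `c = 4πp/q` and let `G X` be `halfPlaneExt (fourierReal P) X`, a one-sided Fourier integral.
Everything is read off from this single family of functions. Since `1/(Ω - t)` is itself a one-sided
exponential integral, `G X` is the Cauchy transform of `D_X P` in the open upper half-plane
(`hilbertOff_divDiff`); by the Poisson and conjugate Poisson limits its boundary values are `S[D_X
P]` (`signal_divDiff`). A change of variables turns the Laplace transform of the kernel into `c⁻¹ G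
X Ω` with `Im Ω > 0` (`kernelLaplace_eq`), up to a conjugation symmetry in `X`. Hence the infimum
vanishes exactly when `c` lies in the closure of the values of the `G X` on the open half-plane
(`penroseInf_eq_zero_iff`).

For (A) ⇒ (B): `G X Ω` is jointly continuous up to the real line and is `O(1/|X|)` and `O(1/|Ω|)`
uniformly. As `c ≠ 0`, compactness shows that `c` is attained on the closed half-plane
(`exists_halfPlaneExt_eq_of_mem_closure`). Interior and boundary points give the two alternatives of
(B).

For (C): by the argument principle, the points enclosed by the boundary curve are exactly the values
of `G X` in the open half-plane that are nonzero and off the curve (`enclosed_eq`). By the open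
mapping theorem, and because a `C¹` curve has dense complement, any nonzero value on the closed
half-plane is a limit of such points (`mem_closure_values_off_curve`). Conversely, enclosed points
are values of `G X`, so (C) gives (A).

The argument principle is proved on the disc without counting zeros: a continuous logarithm on the
circle is approximated by a trigonometric polynomial, and multiplying by the exponential of an
entire function moves the boundary values into the right half-plane, where the maximum principle
applies. The final criterion follows because a curve that crosses the real axis only to the left of
`c` has winding number zero around `c`. -/

namespace Alber

/-! ### The half-plane extension: continuity, holomorphy and uniform decay -/

/-- The multiplier `sin (π X ξ) / (π X)`, extended by `ξ` at `X = 0`. -/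
noncomputable def sineSymbol (X ξ : ℝ) : ℝ := ξ * Real.sinc (Real.pi * X * ξ)

/-- The extension of the signal transform of `D_X P` to the closed upper half-plane, in terms of
the Fourier transform `Q` of `P`. -/
noncomputable def halfPlaneExt (Q : 𝓢(ℝ, ℂ)) (X : ℝ) (Ω : ℂ) : ℂ :=
  4 * Real.pi * ∫ ξ in Set.Ioi (0 : ℝ),
    Complex.exp (2 * Real.pi * Complex.I * Ω * ξ) * (sineSymbol X ξ * Q ξ)

lemma continuous_sineSymbol : Continuous fun z : ℝ × ℝ => sineSymbol z.1 z.2 := by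
  unfold sineSymbol
  have := Real.continuous_sinc
  fun_prop

lemma continuous_sineSymbol_right (X : ℝ) : Continuous (sineSymbol X) :=
  continuous_sineSymbol.comp (by fun_prop : Continuous fun ξ : ℝ => (X, ξ))

lemma abs_sineSymbol_le (X ξ : ℝ) : |sineSymbol X ξ| ≤ |ξ| := by
  unfold sineSymbol
  rw [abs_mul]
  exact mul_le_of_le_one_right (abs_nonneg _) (Real.abs_sinc_le_one _)

lemma mul_sineSymbol (X ξ : ℝ) : Real.pi * X * sineSymbol X ξ = Real.sin (Real.pi * X * ξ) := by
  unfold sineSymbol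
  by_cases h : Real.pi * X * ξ = 0
  · simp [h]
  · rw [Real.sinc_of_ne_zero h, mul_div_assoc', mul_div_assoc', ← mul_assoc,
      mul_div_cancel_left₀ _ h]

lemma sineSymbol_zero_right (X : ℝ) : sineSymbol X 0 = 0 := by simp [sineSymbol]

lemma sineSymbol_zero_left (ξ : ℝ) : sineSymbol 0 ξ = ξ := by simp [sineSymbol]

lemma sineSymbol_of_ne {X : ℝ} (hX : X ≠ 0) (ξ : ℝ) :
    sineSymbol X ξ = Real.sin (Real.pi * X * ξ) / (Real.pi * X) := by
  rw [← mul_sineSymbol]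
  field_simp

lemma abs_sineSymbol_le_inv {X : ℝ} (hX : X ≠ 0) (ξ : ℝ) :
    |sineSymbol X ξ| ≤ (Real.pi * |X|)⁻¹ := by
  rw [sineSymbol_of_ne hX, abs_div, abs_mul, abs_of_pos Real.pi_pos, inv_eq_one_div]
  gcongr
  exact Real.abs_sin_le_one _

lemma hasDerivAt_sineSymbol (X ξ : ℝ) :
    HasDerivAt (sineSymbol X) (Real.cos (Real.pi * X * ξ)) ξ := by
  by_cases hX : X = 0
  · subst hX
    have : sineSymbol 0 = id := by ext; simp [sineSymbol]
    rw [this]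
    simpa using hasDerivAt_id ξ
  · have : sineSymbol X = fun ξ => Real.sin (Real.pi * X * ξ) / (Real.pi * X) :=
      funext (sineSymbol_of_ne hX)
    rw [this]
    have h1 : HasDerivAt (fun ξ : ℝ => Real.pi * X * ξ) (Real.pi * X) ξ := by
      simpa using (hasDerivAt_id ξ).const_mul (Real.pi * X)
    convert! (h1.sin).div_const (Real.pi * X) using 1
    field_simp

lemma norm_exp_two_pi_le {Ω : ℂ} (hΩ : 0 ≤ Ω.im) {ξ : ℝ} (hξ : 0 ≤ ξ) :
    ‖Complex.exp (2 * Real.pi * Complex.I * Ω * ξ)‖ ≤ 1 := by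
  rw [Complex.norm_exp, Real.exp_le_one_iff]
  have : (2 * Real.pi * Complex.I * Ω * ξ : ℂ).re = -(2 * Real.pi * Ω.im * ξ) := by
    simp [mul_assoc]
  rw [this]
  have := Real.pi_pos
  exact neg_nonpos.2 (by positivity)

lemma norm_integrand_le (Q : 𝓢(ℝ, ℂ)) (X : ℝ) {Ω : ℂ} (hΩ : 0 ≤ Ω.im) {ξ : ℝ} (hξ : 0 ≤ ξ) :
    ‖Complex.exp (2 * Real.pi * Complex.I * Ω * ξ) * (sineSymbol X ξ * Q ξ)‖ ≤
      ‖ξ‖ ^ 1 * ‖Q ξ‖ := by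
  rw [norm_mul, norm_mul, pow_one, Complex.norm_real]
  refine (mul_le_of_le_one_left (by positivity) (norm_exp_two_pi_le hΩ hξ)).trans ?_
  gcongr
  exact abs_sineSymbol_le X ξ

lemma continuous_integrand (Q : 𝓢(ℝ, ℂ)) (X : ℝ) (Ω : ℂ) :
    Continuous fun ξ : ℝ =>
      Complex.exp (2 * Real.pi * Complex.I * Ω * ξ) * ((sineSymbol X ξ : ℂ) * Q ξ) := by
  have := continuous_sineSymbol_right X
  have := Q.continuous
  fun_prop

/-- Dominated convergence: on the closed half-plane the exponential has modulus at most 1 and the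
symbol is at most `|ξ|`, so one majorant serves for all `X` and `Ω`. -/
lemma continuousOn_halfPlaneExt (Q : 𝓢(ℝ, ℂ)) :
    ContinuousOn (fun z : ℝ × ℂ => halfPlaneExt Q z.1 z.2) {z | 0 ≤ z.2.im} := by
  intro z₀ _
  refine ContinuousWithinAt.mul continuousWithinAt_const ?_
  refine continuousWithinAt_of_dominated (bound := fun ξ => ‖ξ‖ ^ 1 * ‖Q ξ‖) ?_ ?_ ?_ ?_
  · exact Eventually.of_forall fun z => (continuous_integrand Q z.1 z.2).aestronglyMeasurable
  · filter_upwards [self_mem_nhdsWithin] with z hz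
    filter_upwards [ae_restrict_mem measurableSet_Ioi] with ξ hξ
    exact norm_integrand_le Q z.1 hz (le_of_lt hξ)
  · exact (Q.integrable_pow_mul volume 1).integrableOn
  · refine Eventually.of_forall fun ξ => Continuous.continuousWithinAt ?_
    have : Continuous fun z : ℝ × ℂ => sineSymbol z.1 ξ :=
      continuous_sineSymbol.comp (by fun_prop : Continuous fun z : ℝ × ℂ => (z.1, ξ))
    fun_prop

lemma continuousOn_halfPlaneExt_right (Q : 𝓢(ℝ, ℂ)) (X : ℝ) :
    ContinuousOn (halfPlaneExt Q X) {Ω | 0 ≤ Ω.im} :=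
  (continuousOn_halfPlaneExt Q).comp (f := fun Ω : ℂ => (X, Ω)) (by fun_prop) fun _ h => h

lemma differentiableOn_halfPlaneExt (Q : 𝓢(ℝ, ℂ)) (X : ℝ) :
    DifferentiableOn ℂ (halfPlaneExt Q X) {Ω | 0 < Ω.im} := by
  intro Ω₀ hΩ₀
  refine DifferentiableAt.differentiableWithinAt ?_
  refine DifferentiableAt.const_mul ?_ _
  have hopen : IsOpen {Ω : ℂ | 0 < Ω.im} := isOpen_lt continuous_const Complex.continuous_im
  refine (hasDerivAt_integral_of_dominated_loc_of_deriv_le (s := {Ω : ℂ | 0 < Ω.im})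
    (bound := fun ξ => 2 * Real.pi * (‖ξ‖ ^ 2 * ‖Q ξ‖))
    (F' := fun Ω ξ => 2 * Real.pi * Complex.I * ξ *
      (Complex.exp (2 * Real.pi * Complex.I * Ω * ξ) * ((sineSymbol X ξ : ℂ) * Q ξ)))
    (hopen.mem_nhds hΩ₀) ?_ ?_ ?_ ?_ ?_ ?_).2.differentiableAt
  · exact Eventually.of_forall fun Ω => (continuous_integrand Q X Ω).aestronglyMeasurable
  · refine Integrable.mono' ((Q.integrable_pow_mul volume 1).integrableOn)
      (continuous_integrand Q X Ω₀).aestronglyMeasurable ?_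
    filter_upwards [ae_restrict_mem measurableSet_Ioi] with ξ hξ
    exact norm_integrand_le Q X (le_of_lt hΩ₀) (le_of_lt hξ)
  · have := continuous_integrand Q X Ω₀
    exact (Continuous.mul (by fun_prop) this).aestronglyMeasurable
  · filter_upwards [ae_restrict_mem measurableSet_Ioi] with ξ hξ Ω hΩ
    have h := norm_integrand_le Q X (le_of_lt hΩ) (le_of_lt hξ)
    rw [norm_mul]
    have h2 : ‖(2 * Real.pi * Complex.I * ξ : ℂ)‖ = 2 * Real.pi * ‖ξ‖ := by
      simp [abs_of_pos Real.pi_pos]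
    rw [h2]
    calc _ ≤ 2 * Real.pi * ‖ξ‖ * (‖ξ‖ ^ 1 * ‖Q ξ‖) := by
          have := Real.pi_pos
          gcongr
      _ = _ := by ring
  · exact ((Q.integrable_pow_mul volume 2).const_mul _).integrableOn
  · refine Eventually.of_forall fun ξ Ω _ => ?_
    have h1 : HasDerivAt (fun Ω : ℂ => 2 * Real.pi * Complex.I * Ω * ξ)
        (2 * Real.pi * Complex.I * ξ) Ω := by
      have := ((hasDerivAt_id Ω).const_mul (2 * Real.pi * Complex.I)).mul_const (ξ : ℂ)
      simpa using this
    convert! (h1.cexp).mul_const ((sineSymbol X ξ : ℂ) * Q ξ) using 1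
    ring

/-- For `X ≠ 0` the symbol is a sine divided by `πX`, hence at most `1/(π|X|)`; this confines `X` in
the compactness argument. -/
lemma norm_halfPlaneExt_le_inv_abs (Q : 𝓢(ℝ, ℂ)) :
    ∃ C : ℝ, 0 ≤ C ∧ ∀ X : ℝ, ∀ Ω : ℂ, 0 ≤ Ω.im → |X| * ‖halfPlaneExt Q X Ω‖ ≤ C := by
  refine ⟨4 * ∫ ξ in Set.Ioi (0 : ℝ), ‖Q ξ‖, by positivity, fun X Ω hΩ => ?_⟩
  by_cases hX : X = 0
  · subst hX
    simp only [abs_zero, zero_mul]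
    positivity
  have hb : ‖∫ ξ in Set.Ioi (0 : ℝ),
      Complex.exp (2 * Real.pi * Complex.I * Ω * ξ) * (sineSymbol X ξ * Q ξ)‖ ≤
      ∫ ξ in Set.Ioi (0 : ℝ), (Real.pi * |X|)⁻¹ * ‖Q ξ‖ := by
    refine norm_integral_le_of_norm_le (Q.integrable.norm.const_mul _).integrableOn ?_
    filter_upwards [ae_restrict_mem measurableSet_Ioi] with ξ hξ
    rw [norm_mul, norm_mul, Complex.norm_real]
    refine (mul_le_of_le_one_left (by positivity) (norm_exp_two_pi_le hΩ (le_of_lt hξ))).trans ?_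
    gcongr
    exact abs_sineSymbol_le_inv hX ξ
  rw [integral_const_mul] at hb
  have h4 : ‖(4 * Real.pi : ℂ)‖ = 4 * Real.pi := by simp [abs_of_pos Real.pi_pos]
  rw [halfPlaneExt, norm_mul, h4]
  have hXp : 0 < |X| := abs_pos.2 hX
  have := Real.pi_pos
  refine (mul_le_mul_of_nonneg_left (mul_le_mul_of_nonneg_left hb (by positivity))
    hXp.le).trans_eq ?_
  field_simp

/-- One integration by parts gains a factor `1/Ω`. The boundary term at 0 vanishes with the symbol,
and the derivative of the symbol is a cosine, so the constant does not depend on `X`. -/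
lemma norm_halfPlaneExt_le_inv_norm (Q : 𝓢(ℝ, ℂ)) :
    ∃ C : ℝ, 0 ≤ C ∧ ∀ X : ℝ, ∀ Ω : ℂ, 0 ≤ Ω.im → ‖Ω‖ * ‖halfPlaneExt Q X Ω‖ ≤ C := by
  set Q' : 𝓢(ℝ, ℂ) := SchwartzMap.derivCLM ℝ ℂ Q
  have hQ' : ∀ ξ, HasDerivAt Q (Q' ξ) ξ := fun ξ => by
    rw [SchwartzMap.derivCLM_apply]
    exact Q.differentiableAt.hasDerivAt
  set B : ℝ → ℝ := fun ξ => ‖Q ξ‖ + ‖ξ‖ ^ 1 * ‖Q' ξ‖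
  have hB : Integrable B := Q.integrable.norm.add (Q'.integrable_pow_mul volume 1)
  refine ⟨2 * ∫ ξ in Set.Ioi (0 : ℝ), B ξ, by positivity, fun X Ω hΩ => ?_⟩
  by_cases hΩ0 : Ω = 0
  · rw [hΩ0]
    simp only [norm_zero, zero_mul]
    positivity
  set a : ℂ := 2 * Real.pi * Complex.I * Ω
  have ha : a ≠ 0 := by simp [a, hΩ0, Real.pi_ne_zero]
  set u : ℝ → ℂ := fun ξ => (sineSymbol X ξ : ℂ) * Q ξ
  set u' : ℝ → ℂ := fun ξ => (Real.cos (Real.pi * X * ξ) : ℂ) * Q ξ + (sineSymbol X ξ : ℂ) * Q' ξ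
  set v : ℝ → ℂ := fun ξ => Complex.exp (a * ξ) / a
  have hu : ∀ ξ, HasDerivAt u (u' ξ) ξ := fun ξ =>
    ((hasDerivAt_sineSymbol X ξ).ofReal_comp).mul (hQ' ξ)
  have hv : ∀ ξ : ℝ, HasDerivAt v (Complex.exp (a * ξ)) ξ := fun ξ => by
    have h1 : HasDerivAt (fun ξ : ℝ => a * (ξ : ℂ)) a ξ := by
      simpa using (hasDerivAt_id ξ).ofReal_comp.const_mul a
    convert! (h1.cexp).div_const a using 1
    field_simp
  have hQc := Q.continuous
  have hQc' := Q'.continuous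
  have hsc := continuous_sineSymbol_right X
  have huc : Continuous u := by fun_prop
  have huc' : Continuous u' := by fun_prop
  have hvc : Continuous v := by fun_prop
  have hu'B : ∀ ξ, ‖u' ξ‖ ≤ B ξ := fun ξ => by
    refine (norm_add_le _ _).trans ?_
    simp only [norm_mul, Complex.norm_real, pow_one, B]
    gcongr
    · exact mul_le_of_le_one_left (norm_nonneg _) (Real.abs_cos_le_one _)
    · exact abs_sineSymbol_le X ξ
  have hvB : ∀ ξ : ℝ, 0 ≤ ξ → ‖v ξ‖ ≤ ‖a‖⁻¹ := fun ξ hξ => by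
    rw [norm_div, div_eq_mul_inv]
    exact mul_le_of_le_one_left (by positivity) (norm_exp_two_pi_le hΩ hξ)
  have huv'i : IntegrableOn (u * fun ξ : ℝ => Complex.exp (a * ξ)) (Set.Ioi 0) := by
    refine Integrable.mono' ((Q.integrable_pow_mul volume 1).integrableOn)
      (Continuous.aestronglyMeasurable (by fun_prop)) ?_
    filter_upwards [ae_restrict_mem measurableSet_Ioi] with ξ hξ
    have := norm_integrand_le Q X hΩ (le_of_lt hξ)
    rwa [mul_comm] at this
  have hu'vB : ∀ᵐ ξ ∂(volume.restrict (Set.Ioi (0 : ℝ))), ‖u' ξ * v ξ‖ ≤ ‖a‖⁻¹ * B ξ := by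
    filter_upwards [ae_restrict_mem measurableSet_Ioi] with ξ hξ
    rw [norm_mul, mul_comm]
    exact mul_le_mul (hvB ξ (le_of_lt hξ)) (hu'B ξ) (norm_nonneg _) (by positivity)
  have hu'vi : IntegrableOn (u' * v) (Set.Ioi 0) :=
    Integrable.mono' (hB.const_mul _).integrableOn
      (Continuous.aestronglyMeasurable (by fun_prop)) hu'vB
  have h0 : Tendsto (u * v) (𝓝[>] 0) (𝓝 0) := by
    have : (u * v) 0 = 0 := by simp [u, sineSymbol_zero_right]
    rw [← this]
    exact ((huc.mul hvc).tendsto 0).mono_left nhdsWithin_le_nhds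
  have hinf : Tendsto (u * v) atTop (𝓝 0) := by
    refine squeeze_zero_norm' (a := fun ξ => ‖(‖ξ‖ ^ 1 * ‖Q ξ‖)‖ * ‖a‖⁻¹) ?_ ?_
    · filter_upwards [eventually_ge_atTop 0] with ξ hξ
      simp only [Pi.mul_apply, norm_mul]
      refine mul_le_mul ?_ (hvB ξ hξ) (norm_nonneg _) (by positivity)
      simp only [u, norm_mul, Complex.norm_real, pow_one, norm_norm]
      gcongr
      exact abs_sineSymbol_le X ξ
    · obtain ⟨C, hC⟩ := Q.decay 2 0
      have h1 : Tendsto (fun ξ : ℝ => C * ξ⁻¹ * ‖a‖⁻¹) atTop (𝓝 0) := by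
        simpa using (tendsto_inv_atTop_zero.const_mul C).mul_const ‖a‖⁻¹
      refine squeeze_zero' (Eventually.of_forall fun _ => by positivity) ?_ h1
      filter_upwards [eventually_gt_atTop 0] with ξ hξ
      gcongr
      have := hC.2 ξ
      simp only [norm_iteratedFDeriv_zero, Real.norm_eq_abs, abs_of_pos hξ] at this
      rw [norm_mul, norm_norm, pow_one, norm_norm, Real.norm_eq_abs, abs_of_pos hξ,
        ← div_eq_mul_inv, le_div_iff₀ hξ]
      linarith
  have hparts := integral_Ioi_mul_deriv_eq_deriv_mul (fun ξ _ => hu ξ) (fun ξ _ => hv ξ)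
    huv'i hu'vi h0 hinf
  have hG : halfPlaneExt Q X Ω = 4 * Real.pi * (-∫ ξ in Set.Ioi (0 : ℝ), u' ξ * v ξ) := by
    rw [halfPlaneExt]
    congr 1
    rw [sub_self, zero_sub] at hparts
    rw [← hparts]
    congr 1
    ext ξ
    exact mul_comm _ _
  have hb := norm_integral_le_of_norm_le (hB.const_mul ‖a‖⁻¹).integrableOn hu'vB
  rw [integral_const_mul] at hb
  have h4 : ‖(4 * Real.pi : ℂ)‖ = 4 * Real.pi := by simp [abs_of_pos Real.pi_pos]
  have ha2 : ‖a‖ = 2 * Real.pi * ‖Ω‖ := by simp [a, abs_of_pos Real.pi_pos]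
  rw [hG, norm_mul, norm_neg, h4]
  rw [ha2] at hb
  have hΩp : 0 < ‖Ω‖ := norm_pos_iff.2 hΩ0
  have := Real.pi_pos
  refine (mul_le_mul_of_nonneg_left (mul_le_mul_of_nonneg_left hb (by positivity))
    hΩp.le).trans_eq ?_
  field_simp
  norm_num

/-- The restriction to the line is a reflected Fourier transform of a function with integrable first
moment. The `C¹` regularity is what later makes the complement of the curve dense. -/
lemma contDiff_halfPlaneExt_ofReal (Q : 𝓢(ℝ, ℂ)) (X : ℝ) :
    ContDiff ℝ 1 fun x : ℝ => halfPlaneExt Q X x := by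
  set f : ℝ → ℂ := (Set.Ioi (0 : ℝ)).indicator fun ξ => (sineSymbol X ξ : ℂ) * Q ξ
  have hf : ContDiff ℝ ((1 : ℕ∞) : WithTop ℕ∞) (𝓕 f) := by
    refine Real.contDiff_fourier fun n _ => ?_
    refine (Q.integrable_pow_mul volume (n + 1)).mono' ?_ ?_
    · refine (Continuous.aestronglyMeasurable (by fun_prop)).mul ?_
      refine AEStronglyMeasurable.norm (AEStronglyMeasurable.indicator ?_ measurableSet_Ioi)
      have := continuous_sineSymbol_right X
      have := Q.continuous
      exact Continuous.aestronglyMeasurable (by fun_prop)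
    · refine Eventually.of_forall fun ξ => ?_
      rw [norm_mul, norm_pow, norm_norm, norm_norm, pow_succ, mul_assoc]
      gcongr
      refine (norm_indicator_le_norm_self _ _).trans ?_
      rw [norm_mul, Complex.norm_real]
      gcongr
      exact abs_sineSymbol_le X ξ
  have : (fun x : ℝ => halfPlaneExt Q X x) = fun x => 4 * Real.pi * 𝓕 f (-x) := by
    ext x
    rw [halfPlaneExt, Real.fourier_eq', ← integral_indicator measurableSet_Ioi]
    congr 2
    ext ξ
    simp only [f, Set.indicator_apply]
    split_ifs
    · simp only [smul_eq_mul]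
      congr 2
      simp
      ring
    · simp
  rw [this]
  exact contDiff_const.mul (hf.comp contDiff_neg)

/-! ### The Cauchy transform off the real line as a Fourier integral -/

lemma hilbertOff_conj (u : ℝ → ℝ) (Ω : ℂ) : hilbertOff u (conj Ω) = conj (hilbertOff u Ω) := by
  simp only [hilbertOff, map_mul, map_inv₀, Complex.conj_ofReal]
  rw [← integral_conj]
  simp

lemma inv_sub_eq_integral {Ω : ℂ} (hΩ : 0 < Ω.im) (t : ℝ) :
    (Ω - t)⁻¹ = -(2 * Real.pi * Complex.I) *
      ∫ ξ in Set.Ioi (0 : ℝ), Complex.exp (2 * Real.pi * Complex.I * (Ω - t) * ξ) := by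
  have hne : Ω - t ≠ 0 := fun h => by
    have := congrArg Complex.im h
    simp at this
    exact hΩ.ne' this
  have hre : (2 * Real.pi * Complex.I * (Ω - t) : ℂ).re < 0 := by
    have : (2 * Real.pi * Complex.I * (Ω - t) : ℂ).re = -(2 * Real.pi * Ω.im) := by
      simp [mul_assoc]
    rw [this]
    have := Real.pi_pos
    exact neg_neg_of_pos (by positivity)
  rw [integral_exp_mul_complex_Ioi hre]
  have := Complex.I_ne_zero
  have : (Real.pi : ℂ) ≠ 0 := by exact_mod_cast Real.pi_ne_zero
  simp
  field_simp

/-- Insert the exponential integral for `1/(Ω - t)` and apply Fubini; `Im Ω > 0` makes the double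
integral absolutely convergent. -/
lemma hilbertOff_eq_integral_fourier {u : ℝ → ℝ} (hu : Integrable u) {Ω : ℂ} (hΩ : 0 < Ω.im) :
    hilbertOff u Ω = -(2 * Complex.I) * ∫ ξ in Set.Ioi (0 : ℝ),
      Complex.exp (2 * Real.pi * Complex.I * Ω * ξ) * 𝓕 (fun t : ℝ => (u t : ℂ)) ξ := by
  have hexp : ∀ t ξ : ℝ, Complex.exp (2 * Real.pi * Complex.I * (Ω - t) * ξ) =
      Complex.exp (2 * Real.pi * Complex.I * Ω * ξ) *
        Complex.exp (((-2 * Real.pi * (t * ξ) : ℝ) : ℂ) * Complex.I) := fun t ξ => by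
    rw [← Complex.exp_add]
    congr 1
    push_cast
    ring
  have hint : Integrable (Function.uncurry fun t ξ : ℝ =>
      (u t : ℂ) * Complex.exp (2 * Real.pi * Complex.I * (Ω - t) * ξ))
      (volume.prod (volume.restrict (Set.Ioi (0 : ℝ)))) := by
    have hre : (2 * Real.pi * Complex.I * Ω : ℂ).re < 0 := by
      have : (2 * Real.pi * Complex.I * Ω : ℂ).re = -(2 * Real.pi * Ω.im) := by
        simp [mul_assoc]
      rw [this]
      have := Real.pi_pos
      exact neg_neg_of_pos (by positivity)
    have h1 : Integrable (fun z : ℝ × ℝ => (u z.1 : ℂ) *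
        Complex.exp (2 * Real.pi * Complex.I * Ω * z.2))
        (volume.prod (volume.restrict (Set.Ioi (0 : ℝ)))) :=
      hu.ofReal.mul_prod (integrableOn_exp_mul_complex_Ioi hre 0)
    have h2 := h1.bdd_mul (c := 1)
      (f := fun z : ℝ × ℝ => Complex.exp (((-2 * Real.pi * (z.1 * z.2) : ℝ) : ℂ) * Complex.I))
      (Continuous.aestronglyMeasurable (by fun_prop))
      (Eventually.of_forall fun z => (Complex.norm_exp_ofReal_mul_I _).le)
    refine h2.congr (Eventually.of_forall fun z => ?_)
    simp only [Function.uncurry, hexp]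
    ring
  calc hilbertOff u Ω
      = (Real.pi : ℂ)⁻¹ * ∫ t : ℝ, -(2 * Real.pi * Complex.I) * ∫ ξ in Set.Ioi (0 : ℝ),
          (u t : ℂ) * Complex.exp (2 * Real.pi * Complex.I * (Ω - t) * ξ) := by
        rw [hilbertOff]
        congr 2
        ext t
        rw [integral_const_mul, div_eq_mul_inv, inv_sub_eq_integral hΩ]
        ring
    _ = -(2 * Complex.I) * ∫ t : ℝ, ∫ ξ in Set.Ioi (0 : ℝ),
          (u t : ℂ) * Complex.exp (2 * Real.pi * Complex.I * (Ω - t) * ξ) := by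
        rw [integral_const_mul]
        have : (Real.pi : ℂ) ≠ 0 := by exact_mod_cast Real.pi_ne_zero
        field_simp
    _ = _ := by
        rw [integral_integral_swap hint]
        congr 2
        ext ξ
        rw [Real.fourier_eq', ← integral_const_mul]
        congr 1
        ext t
        rw [hexp]
        simp
        ring_nf

lemma fourier_comp_add (f : ℝ → ℂ) (a ξ : ℝ) :
    𝓕 (fun t => f (t + a)) ξ = Complex.exp (2 * Real.pi * Complex.I * a * ξ) * 𝓕 f ξ := by
  rw [Real.fourier_eq', Real.fourier_eq', ← integral_const_mul,
    ← integral_add_right_eq_self (fun t : ℝ => Complex.exp (2 * Real.pi * Complex.I * a * ξ) *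
      Complex.exp (((-2 * Real.pi * inner ℝ t ξ : ℝ) : ℂ) * Complex.I) • f t) a]
  congr 1
  ext t
  simp only [smul_eq_mul, ← mul_assoc, ← Complex.exp_add]
  congr 2
  simp
  ring

/-- The Fourier transform of a real Schwartz function. -/
noncomputable def fourierReal (P : 𝓢(ℝ, ℝ)) : 𝓢(ℝ, ℂ) :=
  𝓕 (SchwartzMap.postcompCLM (𝕜 := ℝ) Complex.ofRealCLM P)

lemma fourierReal_apply (P : 𝓢(ℝ, ℝ)) (ξ : ℝ) :
    fourierReal P ξ = 𝓕 (fun k : ℝ => (P k : ℂ)) ξ := by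
  rw [fourierReal, SchwartzMap.fourier_coe]
  rfl

lemma contDiff_divDiff (P : 𝓢(ℝ, ℝ)) (X : ℝ) : ContDiff ℝ 1 (divDiff P X) := by
  by_cases hX : X = 0
  · have : divDiff P X = SchwartzMap.derivCLM ℝ ℝ P := by
      ext k; simp [divDiff, hX]
    rw [this]
    exact SchwartzMap.smooth _ 1
  · have : divDiff P X = fun k => (P (k + X / 2) - P (k - X / 2)) / X := by
      ext k; simp [divDiff, hX]
    rw [this]
    have := P.smooth 1
    fun_prop

lemma hasCompactSupport_divDiff {P : ℝ → ℝ} (hP : HasCompactSupport P) (X : ℝ) :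
    HasCompactSupport (divDiff P X) := by
  by_cases hX : X = 0
  · have : divDiff P X = deriv P := by ext k; simp [divDiff, hX]
    rw [this]
    exact hP.deriv
  · have : divDiff P X = fun k => (P (k + X / 2) - P (k - X / 2)) * X⁻¹ := by
      ext k; simp [divDiff, hX, div_eq_mul_inv]
    rw [this]
    exact HasCompactSupport.mul_right
      ((hP.comp_homeomorph (Homeomorph.addRight (X / 2))).sub
        (hP.comp_homeomorph (Homeomorph.subRight (X / 2))))

lemma fourier_divDiff (P : 𝓢(ℝ, ℝ)) (X ξ : ℝ) :
    𝓕 (fun k : ℝ => (divDiff P X k : ℂ)) ξ =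
      2 * Real.pi * Complex.I * (sineSymbol X ξ * fourierReal P ξ) := by
  rw [fourierReal_apply]
  have hPi : Integrable fun k : ℝ => (P k : ℂ) := P.integrable.ofReal
  by_cases hX : X = 0
  · subst hX
    have hd : ∀ k, HasDerivAt (fun k : ℝ => (P k : ℂ)) ((deriv P k : ℝ) : ℂ) k := fun k =>
      P.differentiableAt.hasDerivAt.ofReal_comp
    have h1 : (fun k : ℝ => (divDiff P 0 k : ℂ)) = deriv fun k : ℝ => (P k : ℂ) := by
      ext k
      rw [(hd k).deriv]
      simp [divDiff]
    have h2 : Integrable (deriv fun k : ℝ => (P k : ℂ)) := by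
      have : (deriv fun k : ℝ => (P k : ℂ)) =
          fun k => ((SchwartzMap.derivCLM ℝ ℝ P k : ℝ) : ℂ) := by
        ext k
        rw [(hd k).deriv]
        simp
      rw [this]
      exact (SchwartzMap.derivCLM ℝ ℝ P).integrable.ofReal
    rw [h1, Real.fourier_deriv hPi (fun k => (hd k).differentiableAt) h2, sineSymbol_zero_left]
    simp only [smul_eq_mul]
    ring
  · have h1 : (fun k : ℝ => (divDiff P X k : ℂ)) = (X : ℂ)⁻¹ •
        ((fun k : ℝ => (P (k + X / 2) : ℂ)) - fun k : ℝ => (P (k + -(X / 2)) : ℂ)) := by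
      ext k
      simp [divDiff, hX, div_eq_mul_inv, sub_eq_add_neg]
      ring
    have hsub : 𝓕 ((fun k : ℝ => (P (k + X / 2) : ℂ)) - fun k : ℝ => (P (k + -(X / 2)) : ℂ)) ξ =
        𝓕 (fun k : ℝ => (P (k + X / 2) : ℂ)) ξ - 𝓕 (fun k : ℝ => (P (k + -(X / 2)) : ℂ)) ξ := by
      simp only [Real.fourier_eq]
      rw [← integral_sub]
      · simp [smul_sub]
      · exact (Real.fourierIntegral_convergent_iff ξ).2 (hPi.comp_add_right (X / 2))
      · exact (Real.fourierIntegral_convergent_iff ξ).2 (hPi.comp_add_right (-(X / 2)))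
    have hsmul : ∀ f : ℝ → ℂ, 𝓕 ((X : ℂ)⁻¹ • f) ξ = (X : ℂ)⁻¹ * 𝓕 f ξ := fun f => by
      rw [Real.fourier_eq', Real.fourier_eq', ← integral_const_mul]
      congr 1
      ext t
      simp
      ring
    rw [h1, hsmul, hsub, fourier_comp_add (fun k : ℝ => (P k : ℂ)) (X / 2),
      fourier_comp_add (fun k : ℝ => (P k : ℂ)) (-(X / 2)), sineSymbol_of_ne hX]
    push_cast
    rw [Complex.sin]
    have hpi : (Real.pi : ℂ) ≠ 0 := by exact_mod_cast Real.pi_ne_zero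
    have hX' : (X : ℂ) ≠ 0 := by exact_mod_cast hX
    have e1 : (2 * Real.pi * Complex.I * (X / 2) * ξ : ℂ) = Real.pi * X * ξ * Complex.I := by ring
    have e2 : (2 * Real.pi * Complex.I * -(X / 2) * ξ : ℂ) = -(Real.pi * X * ξ) * Complex.I := by
      ring
    rw [e1, e2]
    generalize Complex.exp (Real.pi * X * ξ * Complex.I) = a
    generalize Complex.exp (-(Real.pi * X * ξ) * Complex.I) = b
    field_simp
    linear_combination ((a - b) * 𝓕 (fun k : ℝ => (P k : ℂ)) ξ) * Complex.I_sq

lemma hilbertOff_divDiff (P : 𝓢(ℝ, ℝ)) (hP : HasCompactSupport P) (X : ℝ) {Ω : ℂ}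
    (hΩ : 0 < Ω.im) : hilbertOff (divDiff P X) Ω = halfPlaneExt (fourierReal P) X Ω := by
  rw [hilbertOff_eq_integral_fourier ((contDiff_divDiff P X).continuous.integrable_of_hasCompactSupport
    (hasCompactSupport_divDiff hP X)) hΩ, halfPlaneExt]
  simp only [fourier_divDiff]
  rw [← integral_const_mul, ← integral_const_mul]
  congr 1
  ext ξ
  linear_combination (-(4 * Real.pi * Complex.exp (2 * Real.pi * Complex.I * Ω * ξ) *
    sineSymbol X ξ * fourierReal P ξ)) * Complex.I_sq

/-! ### Principal values and boundary values on the real line -/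

lemma integral_eq_integral_Ioi_add_neg {g : ℝ → ℝ} (hg : Integrable g) :
    ∫ s, g s = ∫ s in Set.Ioi (0 : ℝ), (g s + g (-s)) := by
  rw [integral_add hg.integrableOn hg.comp_neg.integrableOn, integral_comp_neg_Ioi, neg_zero,
    add_comm, intervalIntegral.integral_Iic_add_Ioi hg.integrableOn hg.integrableOn]

/-- The symmetrized kernel whose integral over `(0, ∞)` is the principal value. -/
noncomputable def symmQuot (u : ℝ → ℝ) (x s : ℝ) : ℝ := (u (x - s) - u (x + s)) / s

lemma measurable_symmQuot {u : ℝ → ℝ} (hu : Continuous u) (x : ℝ) :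
    Measurable (symmQuot u x) := by
  unfold symmQuot
  exact Measurable.div (by fun_prop) measurable_id

/-- With Lipschitz constant `K`, the quotient is at most `2K`. Once `s > R + |x|`, both `x - s` and
`x + s` have left the support, which lies in `[-R, R]`. -/
lemma integrableOn_symmQuot {u : ℝ → ℝ} (hu : ContDiff ℝ 1 u) (hc : HasCompactSupport u) (x : ℝ) :
    IntegrableOn (symmQuot u x) (Set.Ioi 0) := by
  obtain ⟨K, hK⟩ := hu.lipschitzWith_of_hasCompactSupport hc one_ne_zero
  obtain ⟨R, hR⟩ := hc.isCompact.isBounded.subset_closedBall 0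
  have hz : ∀ y, R < |y| → u y = 0 := fun y hy => by
    by_contra h
    have := hR (subset_tsupport u h)
    rw [mem_closedBall_zero_iff, Real.norm_eq_abs] at this
    linarith
  have hb : Integrable ((Set.Icc (0 : ℝ) (R + |x|)).indicator fun _ => 2 * (K : ℝ)) :=
    (integrable_indicator_iff measurableSet_Icc).2 (integrableOn_const (by simp))
  refine hb.integrableOn.mono' (measurable_symmQuot hu.continuous x).aestronglyMeasurable ?_
  filter_upwards [ae_restrict_mem measurableSet_Ioi] with s (hs : 0 < s)
  by_cases hsR : s ≤ R + |x|
  · rw [Set.indicator_of_mem (by exact ⟨hs.le, hsR⟩)]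
    have := hK.dist_le_mul (x - s) (x + s)
    rw [Real.dist_eq, Real.dist_eq] at this
    rw [symmQuot, norm_div, Real.norm_eq_abs, Real.norm_eq_abs, abs_of_pos hs, div_le_iff₀ hs]
    refine this.trans_eq ?_
    have : x - s - (x + s) = -(2 * s) := by ring
    rw [this, abs_neg, abs_of_pos (by positivity)]
    ring
  · push Not at hsR
    have hx := neg_abs_le x
    have hx' := le_abs_self x
    have h1 : u (x - s) = 0 := hz _ (by rw [abs_sub_comm]; linarith [le_abs_self (s - x)])
    have h2 : u (x + s) = 0 := hz _ (by linarith [le_abs_self (x + s)])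
    simp only [symmQuot, h1, h2, sub_self, zero_div, norm_zero]
    exact Set.indicator_nonneg (fun _ _ => by positivity) _

lemma hilbertTrunc_eq {u : ℝ → ℝ} (hu : Integrable u) (x : ℝ) {ε : ℝ} (hε : 0 < ε) :
    hilbertTrunc u x ε = Real.pi⁻¹ *
      ∫ s in Set.Ioi (0 : ℝ), (Set.Ioi ε).indicator (symmQuot u x) s := by
  have hm : MeasurableSet {t : ℝ | ε < |x - t|} :=
    measurableSet_lt measurable_const (by fun_prop)
  rw [hilbertTrunc, ← integral_indicator hm, ← integral_sub_left_eq_self _ _ x]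
  set g : ℝ → ℝ := fun s => {t : ℝ | ε < |x - t|}.indicator (fun t => u t / (x - t)) (x - s)
  have hge : ∀ s, g s = if ε < |s| then u (x - s) / s else 0 := fun s => by
    simp [g, Set.indicator_apply]
  have hg : Integrable g := by
    have h1 : Integrable fun s => u (x - s) := hu.comp_sub_left x
    have h2 := h1.bdd_mul (c := ε⁻¹) (f := fun s : ℝ => if ε < |s| then s⁻¹ else 0)
      (Measurable.aestronglyMeasurable (Measurable.ite
        (measurableSet_lt measurable_const (by fun_prop)) measurable_inv measurable_const))
      (Eventually.of_forall fun s => by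
        split_ifs with h
        · rw [norm_inv, Real.norm_eq_abs]
          exact inv_anti₀ hε h.le
        · simpa using hε.le)
    refine h2.congr (Eventually.of_forall fun s => ?_)
    simp only [hge]
    split_ifs
    · rw [div_eq_mul_inv, mul_comm]
    · simp
  rw [integral_eq_integral_Ioi_add_neg hg]
  congr 1
  refine setIntegral_congr_fun measurableSet_Ioi fun s (hs : 0 < s) => ?_
  simp only [hge, Set.indicator_apply, Set.mem_Ioi, abs_neg, abs_of_pos hs, symmQuot, sub_neg_eq_add]
  split_ifs
  · field_simp
    ring
  · simp

lemma tendsto_hilbertTrunc {u : ℝ → ℝ} (hu : ContDiff ℝ 1 u) (hc : HasCompactSupport u) (x : ℝ) :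
    Tendsto (hilbertTrunc u x) (𝓝[>] 0)
      (𝓝 (Real.pi⁻¹ * ∫ s in Set.Ioi (0 : ℝ), symmQuot u x s)) := by
  have hui : Integrable u := hu.continuous.integrable_of_hasCompactSupport hc
  have h : Tendsto (fun ε => Real.pi⁻¹ *
      ∫ s in Set.Ioi (0 : ℝ), (Set.Ioi ε).indicator (symmQuot u x) s) (𝓝[>] 0)
      (𝓝 (Real.pi⁻¹ * ∫ s in Set.Ioi (0 : ℝ), symmQuot u x s)) := by
    refine Tendsto.const_mul _ ?_
    refine tendsto_integral_filter_of_dominated_convergence (fun s => ‖symmQuot u x s‖) ?_ ?_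
      (integrableOn_symmQuot hu hc x).norm ?_
    · exact Eventually.of_forall fun ε =>
        ((measurable_symmQuot hu.continuous x).indicator measurableSet_Ioi).aestronglyMeasurable
    · exact Eventually.of_forall fun ε => Eventually.of_forall fun s =>
        norm_indicator_le_norm_self _ _
    · filter_upwards [ae_restrict_mem measurableSet_Ioi] with s (hs : 0 < s)
      refine tendsto_const_nhds.congr' ?_
      filter_upwards [nhdsWithin_le_nhds (Iio_mem_nhds hs)] with ε hε
      exact (Set.indicator_of_mem (show s ∈ Set.Ioi ε from hε) _).symm
  refine h.congr' ?_
  filter_upwards [self_mem_nhdsWithin] with ε hε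
  exact (hilbertTrunc_eq hui x hε).symm

lemma hilbert_eq {u : ℝ → ℝ} (hu : ContDiff ℝ 1 u) (hc : HasCompactSupport u) (x : ℝ) :
    hilbert u x = Real.pi⁻¹ * ∫ s in Set.Ioi (0 : ℝ), symmQuot u x s :=
  (tendsto_hilbertTrunc hu hc x).limUnder_eq

lemma integrable_conjPoisson {u : ℝ → ℝ} (hu : Continuous u) (hc : HasCompactSupport u) (x : ℝ)
    {ε : ℝ} (hε : 0 < ε) : Integrable fun s => u (x - s) * (s / (s ^ 2 + ε ^ 2)) := by
  refine Continuous.integrable_of_hasCompactSupport ?_ ?_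
  · have : ∀ s : ℝ, s ^ 2 + ε ^ 2 ≠ 0 := fun s => by positivity
    fun_prop (disch := assumption)
  · exact HasCompactSupport.mul_right (hc.comp_homeomorph (Homeomorph.subLeft x))

lemma integrable_poisson {u : ℝ → ℝ} (hu : Continuous u) (hc : HasCompactSupport u) (x : ℝ)
    {ε : ℝ} (hε : 0 < ε) : Integrable fun s => u (x - s) * (ε / (s ^ 2 + ε ^ 2)) := by
  refine Continuous.integrable_of_hasCompactSupport ?_ ?_
  · have : ∀ s : ℝ, s ^ 2 + ε ^ 2 ≠ 0 := fun s => by positivity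
    fun_prop (disch := assumption)
  · exact HasCompactSupport.mul_right (hc.comp_homeomorph (Homeomorph.subLeft x))

/-- Splits `1/(s + iε)` into its real and imaginary parts, the conjugate Poisson and Poisson
kernels. -/
lemma hilbertOff_add_mul_I {u : ℝ → ℝ} (hu : Continuous u) (hc : HasCompactSupport u) (x : ℝ)
    {ε : ℝ} (hε : 0 < ε) :
    hilbertOff u (x + ε * Complex.I) =
      ((Real.pi⁻¹ * ∫ s, u (x - s) * (s / (s ^ 2 + ε ^ 2)) : ℝ) : ℂ) -
      Complex.I * ((Real.pi⁻¹ * ∫ s, u (x - s) * (ε / (s ^ 2 + ε ^ 2)) : ℝ) : ℂ) := by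
  rw [hilbertOff, ← integral_sub_left_eq_self _ _ x]
  push_cast
  rw [mul_left_comm, ← mul_sub]
  congr 1
  rw [← integral_complex_ofReal, ← integral_complex_ofReal, ← integral_const_mul, ← integral_sub]
  · congr 1
    ext s
    have h1 : (x + ε * Complex.I - (x - s) : ℂ) = s + ε * Complex.I := by ring
    have h2 : (s ^ 2 + ε ^ 2 : ℂ) ≠ 0 := by
      have : s ^ 2 + ε ^ 2 ≠ 0 := by positivity
      exact_mod_cast this
    have h4 : (s ^ 2 + ε ^ 2 : ℂ) = (s + ε * Complex.I) * (s - ε * Complex.I) := by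
      linear_combination ((ε : ℂ) ^ 2) * Complex.I_sq
    have h3 : (s + ε * Complex.I : ℂ) ≠ 0 := fun h => h2 (by rw [h4, h, zero_mul])
    push_cast
    rw [h1]
    rw [div_eq_iff h3]
    field_simp
    linear_combination (u (x - s) : ℂ) * h4
  · exact (integrable_conjPoisson hu hc x hε).ofReal
  · exact (integrable_poisson hu hc x hε).ofReal.const_mul _

/-- Oddness of the kernel folds the integral onto `(0, ∞)`, where it becomes `symmQuot` times
`s²/(s² + ε²)`, a factor bounded by 1 and tending to 1. -/
lemma tendsto_conjPoisson {u : ℝ → ℝ} (hu : ContDiff ℝ 1 u) (hc : HasCompactSupport u) (x : ℝ) :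
    Tendsto (fun ε : ℝ => ∫ s, u (x - s) * (s / (s ^ 2 + ε ^ 2))) (𝓝[>] 0)
      (𝓝 (∫ s in Set.Ioi (0 : ℝ), symmQuot u x s)) := by
  have h : Tendsto (fun ε : ℝ => ∫ s in Set.Ioi (0 : ℝ),
      symmQuot u x s * (s ^ 2 / (s ^ 2 + ε ^ 2))) (𝓝[>] 0)
      (𝓝 (∫ s in Set.Ioi (0 : ℝ), symmQuot u x s)) := by
    refine tendsto_integral_filter_of_dominated_convergence (fun s => ‖symmQuot u x s‖) ?_ ?_
      (integrableOn_symmQuot hu hc x).norm ?_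
    · exact Eventually.of_forall fun ε =>
        ((measurable_symmQuot hu.continuous x).mul (by fun_prop)).aestronglyMeasurable
    · refine Eventually.of_forall fun ε => Eventually.of_forall fun s => ?_
      rw [norm_mul, Real.norm_of_nonneg (by positivity : 0 ≤ s ^ 2 / (s ^ 2 + ε ^ 2))]
      refine mul_le_of_le_one_right (norm_nonneg _) (div_le_one_of_le₀ ?_ (by positivity))
      nlinarith [sq_nonneg ε]
    · filter_upwards [ae_restrict_mem measurableSet_Ioi] with s (hs : 0 < s)
      have hcont : ContinuousAt (fun ε : ℝ => symmQuot u x s * (s ^ 2 / (s ^ 2 + ε ^ 2))) 0 := by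
        have : s ^ 2 + (0 : ℝ) ^ 2 ≠ 0 := by positivity
        fun_prop (disch := assumption)
      have := hcont.tendsto.mono_left (nhdsWithin_le_nhds (s := Set.Ioi 0))
      have h0 : symmQuot u x s * (s ^ 2 / (s ^ 2 + (0 : ℝ) ^ 2)) = symmQuot u x s := by
        field_simp
        simp
      rwa [h0] at this
  refine h.congr' ?_
  filter_upwards [self_mem_nhdsWithin] with ε (hε : 0 < ε)
  rw [integral_eq_integral_Ioi_add_neg (integrable_conjPoisson hu.continuous hc x hε)]
  refine setIntegral_congr_fun measurableSet_Ioi fun s (hs : 0 < s) => ?_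
  have : s ^ 2 + ε ^ 2 ≠ 0 := by positivity
  simp only [symmQuot, sub_neg_eq_add, neg_sq]
  field_simp
  ring

lemma tendsto_poisson {u : ℝ → ℝ} (hu : Continuous u) (hc : HasCompactSupport u) (x : ℝ) :
    Tendsto (fun ε : ℝ => ∫ s, u (x - s) * (ε / (s ^ 2 + ε ^ 2))) (𝓝[>] 0)
      (𝓝 (Real.pi * u x)) := by
  obtain ⟨M, hM⟩ := hc.exists_bound_of_continuous hu
  have h : Tendsto (fun ε : ℝ => ∫ s, u (x - ε * s) * (1 + s ^ 2)⁻¹) (𝓝[>] 0)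
      (𝓝 (∫ s, u x * (1 + s ^ 2)⁻¹)) := by
    refine tendsto_integral_filter_of_dominated_convergence (fun s => M * (1 + s ^ 2)⁻¹) ?_ ?_
      (integrable_inv_one_add_sq.const_mul M) ?_
    · refine Eventually.of_forall fun ε => Continuous.aestronglyMeasurable ?_
      have : ∀ s : ℝ, 1 + s ^ 2 ≠ 0 := fun s => by positivity
      fun_prop (disch := assumption)
    · refine Eventually.of_forall fun ε => Eventually.of_forall fun s => ?_
      rw [norm_mul, Real.norm_of_nonneg (by positivity : 0 ≤ (1 + s ^ 2)⁻¹)]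
      gcongr
      exact hM _
    · refine Eventually.of_forall fun s => Tendsto.mul_const _ ?_
      have hcont : Continuous fun ε : ℝ => u (x - ε * s) := by fun_prop
      have := (hcont.tendsto 0).mono_left (nhdsWithin_le_nhds (s := Set.Ioi 0))
      simpa using this
  rw [integral_const_mul, integral_univ_inv_one_add_sq, mul_comm] at h
  refine h.congr' ?_
  filter_upwards [self_mem_nhdsWithin] with ε (hε : 0 < ε)
  -- Rescaling `s` to `εs` turns the Poisson kernel into `1/(1 + s²)`, whose integral is `π`.
  have := Measure.integral_comp_mul_left (fun s => u (x - s) * (ε / (s ^ 2 + ε ^ 2))) ε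
  rw [abs_of_pos (inv_pos.2 hε), smul_eq_mul, ← div_eq_inv_mul, eq_div_iff hε.ne',
    ← integral_mul_const] at this
  rw [← this]
  congr 1
  ext s
  have : 1 + s ^ 2 ≠ 0 := by positivity
  have : (ε * s) ^ 2 + ε ^ 2 ≠ 0 := by positivity
  field_simp
  ring

lemma tendsto_hilbertOff {u : ℝ → ℝ} (hu : ContDiff ℝ 1 u) (hc : HasCompactSupport u) (x : ℝ) :
    Tendsto (fun ε : ℝ => hilbertOff u (x + ε * Complex.I)) (𝓝[>] 0) (𝓝 (signal u x)) := by
  have h1 := ((tendsto_conjPoisson hu hc x).const_mul Real.pi⁻¹)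
  have h2 := ((tendsto_poisson hu.continuous hc x).const_mul Real.pi⁻¹)
  rw [← mul_assoc, inv_mul_cancel₀ Real.pi_ne_zero, one_mul] at h2
  rw [← hilbert_eq hu hc] at h1
  have h3 := (((Complex.continuous_ofReal.tendsto _).comp h1).sub
    (((Complex.continuous_ofReal.tendsto _).comp h2).const_mul Complex.I))
  refine h3.congr' ?_
  filter_upwards [self_mem_nhdsWithin] with ε (hε : 0 < ε)
  exact (hilbertOff_add_mul_I hu.continuous hc x hε).symm

/-- Both sides are the limit of the same Cauchy transform as the point is approached vertically from
above. -/
lemma signal_divDiff (P : 𝓢(ℝ, ℝ)) (hP : HasCompactSupport P) (X x : ℝ) :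
    signal (divDiff P X) x = halfPlaneExt (fourierReal P) X x := by
  refine tendsto_nhds_unique (tendsto_hilbertOff (contDiff_divDiff P X)
    (hasCompactSupport_divDiff hP X) x) ?_
  have h1 := continuousOn_halfPlaneExt_right (fourierReal P) X (x : ℂ) (by simp)
  have h2 : Tendsto (fun ε : ℝ => (x + ε * Complex.I : ℂ)) (𝓝[>] 0) (𝓝[{Ω | 0 ≤ Ω.im}] x) := by
    refine tendsto_nhdsWithin_iff.2 ⟨?_, ?_⟩
    · have : Continuous fun ε : ℝ => (x + ε * Complex.I : ℂ) := by fun_prop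
      simpa using (this.tendsto 0).mono_left (nhdsWithin_le_nhds (s := Set.Ioi 0))
    · filter_upwards [self_mem_nhdsWithin] with ε (hε : 0 < ε)
      simpa using hε.le
  refine (h1.tendsto.comp h2).congr' ?_
  filter_upwards [self_mem_nhdsWithin] with ε (hε : 0 < ε)
  exact (hilbertOff_divDiff P hP X (by simpa using hε)).symm

/-! ### The Laplace transform of the kernel and the Penrose infimum -/

lemma sineSymbol_neg_left (X ξ : ℝ) : sineSymbol (-X) ξ = sineSymbol X ξ := by
  rw [sineSymbol, sineSymbol, mul_neg, neg_mul, Real.sinc_neg]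

lemma halfPlaneExt_neg (Q : 𝓢(ℝ, ℂ)) (X : ℝ) (Ω : ℂ) :
    halfPlaneExt Q (-X) Ω = halfPlaneExt Q X Ω := by
  simp only [halfPlaneExt, sineSymbol_neg_left]

/-- Substitute `ξ = -2πpXt`. The sign condition on `pX` keeps the range equal to `(0, ∞)`, and `Ω`
is chosen so that `2πiΩξ = -ωt`. -/
lemma kernelLaplace_eq (P : 𝓢(ℝ, ℝ)) {p : ℝ} (q : ℝ) {X : ℝ} (hpX : p * X < 0) (ω : ℂ) :
    kernelLaplace P p q X ω = (q / (4 * Real.pi * p) : ℝ) *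
      halfPlaneExt (fourierReal P) X (-Complex.I * ω / (4 * Real.pi ^ 2 * p * X)) := by
  have hpi := Real.pi_pos
  have hb : 0 < -(2 * Real.pi * p * X) := by
    have : -(2 * Real.pi * p * X) = 2 * Real.pi * -(p * X) := by ring
    rw [this]
    exact mul_pos (by positivity) (neg_pos.2 hpX)
  have hp : (p : ℂ) ≠ 0 := by
    rintro h
    rw [Complex.ofReal_eq_zero.1 h, zero_mul] at hpX
    exact lt_irrefl _ hpX
  have hX : (X : ℂ) ≠ 0 := by
    rintro h
    rw [Complex.ofReal_eq_zero.1 h, mul_zero] at hpX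
    exact lt_irrefl _ hpX
  have hpi' : (Real.pi : ℂ) ≠ 0 := by exact_mod_cast hpi.ne'
  set Ω : ℂ := -Complex.I * ω / (4 * Real.pi ^ 2 * p * X) with hΩ
  set g : ℝ → ℂ := fun ξ => (-(2 * Real.pi * q * X) : ℂ) *
    (Complex.exp (2 * Real.pi * Complex.I * Ω * ξ) * (sineSymbol X ξ * fourierReal P ξ))
  have hsub : kernelLaplace P p q X ω =
      ∫ t in Set.Ioi (0 : ℝ), g (-(2 * Real.pi * p * X) * t) := by
    rw [kernelLaplace]
    congr 1
    ext t
    have h1 : Complex.exp (2 * Real.pi * Complex.I * Ω * (-(2 * Real.pi * p * X) * t : ℝ)) =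
        Complex.exp (-ω * t) := by
      congr 1
      rw [hΩ]
      push_cast
      field_simp
      linear_combination (4 * ω * t) * Complex.I_sq
    have h2 : Real.sin (2 * Real.pi ^ 2 * p * X ^ 2 * t) =
        -(Real.pi * X * sineSymbol X (-(2 * Real.pi * p * X) * t)) := by
      rw [mul_sineSymbol, ← Real.sin_neg]
      congr 1
      ring
    have h3 : (𝓕⁻ (fun k : ℝ => (P k : ℂ))) (2 * Real.pi * p * X * t) =
        fourierReal P (-(2 * Real.pi * p * X) * t) := by
      rw [Real.fourierInv_eq_fourier_neg, fourierReal_apply, neg_mul]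
    simp only [g, kernel]
    rw [h1, h2, h3]
    push_cast
    ring
  rw [hsub, integral_comp_mul_left_Ioi g 0 hb, mul_zero, integral_const_mul, halfPlaneExt,
    Complex.real_smul]
  push_cast
  field_simp

lemma kernel_neg (P : ℝ → ℝ) (p q X t : ℝ) :
    kernel P p q (-X) t = conj (kernel P p q X t) := by
  have : (𝓕⁻ (fun k : ℝ => (P k : ℂ))) (2 * Real.pi * p * -X * t) =
      conj ((𝓕⁻ (fun k : ℝ => (P k : ℂ))) (2 * Real.pi * p * X * t)) := by
    rw [Real.fourierInv_eq', Real.fourierInv_eq', ← integral_conj]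
    congr 1
    ext k
    simp only [smul_eq_mul, map_mul, ← Complex.exp_conj, Complex.conj_ofReal, Complex.conj_I]
    congr 2
    simp
  simp only [kernel, this, map_mul, Complex.conj_ofReal, neg_sq, map_ofNat]

lemma kernelLaplace_neg (P : ℝ → ℝ) (p q X : ℝ) (ω : ℂ) :
    kernelLaplace P p q (-X) ω = conj (kernelLaplace P p q X (conj ω)) := by
  rw [kernelLaplace, kernelLaplace, ← integral_conj]
  congr 1
  ext t
  rw [kernel_neg, map_mul, ← Complex.exp_conj]
  simp

lemma kernelLaplace_zero (P : ℝ → ℝ) (p q : ℝ) (ω : ℂ) : kernelLaplace P p q 0 ω = 0 := by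
  simp [kernelLaplace, kernel]

lemma im_neg_I_mul_div (p X : ℝ) (ω : ℂ) :
    (-Complex.I * ω / (4 * Real.pi ^ 2 * p * X)).im = -ω.re / (4 * Real.pi ^ 2 * (p * X)) := by
  have : (-Complex.I * ω / (4 * Real.pi ^ 2 * p * X)) =
      -Complex.I * ω / ((4 * Real.pi ^ 2 * (p * X) : ℝ) : ℂ) := by
    push_cast
    ring
  rw [this, Complex.div_ofReal_im]
  simp

/-- When `pX > 0`, pass to `-X` and the conjugate of `ω`: this conjugates the Laplace transform and
leaves the norm unchanged, while `halfPlaneExt` is even in `X`. -/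
lemma exists_norm_one_sub_kernelLaplace_eq (P : 𝓢(ℝ, ℝ)) {p : ℝ} (hp : p ≠ 0) (q : ℝ) {X : ℝ}
    (hX : X ≠ 0) {ω : ℂ} (hω : 0 < ω.re) :
    ∃ Ω : ℂ, 0 < Ω.im ∧ ‖1 - kernelLaplace P p q X ω‖ =
      ‖1 - (q / (4 * Real.pi * p) : ℝ) * halfPlaneExt (fourierReal P) X Ω‖ := by
  have key : ∀ X : ℝ, p * X < 0 → ∀ ω : ℂ, 0 < ω.re →
      0 < (-Complex.I * ω / (4 * Real.pi ^ 2 * p * X)).im := fun X h ω hω => by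
    rw [im_neg_I_mul_div]
    refine div_pos_of_neg_of_neg (neg_neg_of_pos hω) (mul_neg_of_pos_of_neg ?_ h)
    have := Real.pi_pos
    positivity
  rcases lt_or_gt_of_ne (mul_ne_zero hp hX) with h | h
  · exact ⟨_, key X h ω hω, by rw [kernelLaplace_eq P q h]⟩
  · have h' : p * -X < 0 := by linarith
    have hω' : 0 < (conj ω).re := by simpa using hω
    refine ⟨_, key (-X) h' _ hω', ?_⟩
    have h2 := kernelLaplace_neg P p q (-X) ω
    rw [neg_neg, kernelLaplace_eq P q h', halfPlaneExt_neg] at h2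
    rw [h2, ← Complex.norm_conj]
    simp

lemma exists_kernelLaplace_eq (P : 𝓢(ℝ, ℝ)) {p : ℝ} (hp : p ≠ 0) (q : ℝ) {X : ℝ}
    (hX : X ≠ 0) {Ω : ℂ} (hΩ : 0 < Ω.im) :
    ∃ (X' : ℝ) (ω : ℂ), 0 < ω.re ∧ kernelLaplace P p q X' ω =
      (q / (4 * Real.pi * p) : ℝ) * halfPlaneExt (fourierReal P) X Ω := by
  obtain ⟨X', hX', hG⟩ : ∃ X' : ℝ, p * X' < 0 ∧
      halfPlaneExt (fourierReal P) X' Ω = halfPlaneExt (fourierReal P) X Ω := by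
    rcases lt_or_gt_of_ne (mul_ne_zero hp hX) with h | h
    · exact ⟨X, h, rfl⟩
    · exact ⟨-X, by linarith, halfPlaneExt_neg _ _ _⟩
  have hpi := Real.pi_pos
  have hp' : (p : ℂ) ≠ 0 := by exact_mod_cast hp
  have hX0 : (X' : ℂ) ≠ 0 := by
    rintro h
    rw [Complex.ofReal_eq_zero.1 h, mul_zero] at hX'
    exact lt_irrefl _ hX'
  have hpi' : (Real.pi : ℂ) ≠ 0 := by exact_mod_cast hpi.ne'
  refine ⟨X', Complex.I * ((4 * Real.pi ^ 2 * (p * X') : ℝ) : ℂ) * Ω, ?_, ?_⟩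
  · have : (Complex.I * ((4 * Real.pi ^ 2 * (p * X') : ℝ) : ℂ) * Ω).re =
        4 * Real.pi ^ 2 * -(p * X') * Ω.im := by
      rw [mul_assoc, Complex.I_mul_re, Complex.im_ofReal_mul]
      ring
    rw [this]
    have : 0 < -(p * X') := neg_pos.2 hX'
    positivity
  · rw [kernelLaplace_eq P q hX', ← hG]
    congr 2
    push_cast
    field_simp
    linear_combination (-Ω) * Complex.I_sq

lemma penroseInf_nonneg (P : ℝ → ℝ) (p q : ℝ) : 0 ≤ penroseInf P p q :=
  Real.iInf_nonneg fun _ => norm_nonneg _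

lemma not_isStable_iff (P : ℝ → ℝ) (p q : ℝ) : ¬ IsStable P p q ↔ penroseInf P p q = 0 := by
  constructor
  · intro h
    by_contra h0
    exact h ⟨_, lt_of_le_of_ne (penroseInf_nonneg P p q) (Ne.symm h0), le_rfl⟩
  · rintro h ⟨κ, hκ, hle⟩
    linarith

lemma penroseInf_eq_zero_iff (P : 𝓢(ℝ, ℝ)) {p q : ℝ} (hp : p ≠ 0) (hq : q ≠ 0) :
    penroseInf P p q = 0 ↔ ((4 * Real.pi * p / q : ℝ) : ℂ) ∈
      closure {z | ∃ (X : ℝ) (Ω : ℂ), X ≠ 0 ∧ 0 < Ω.im ∧ halfPlaneExt (fourierReal P) X Ω = z} := by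
  set c : ℝ := 4 * Real.pi * p / q with hc
  have hc0 : c ≠ 0 := by
    have := Real.pi_ne_zero
    positivity
  have hcinv : q / (4 * Real.pi * p) = c⁻¹ := by rw [hc, inv_div]
  have hdist : ∀ z : ℂ, ‖1 - (q / (4 * Real.pi * p) : ℝ) * z‖ = |c|⁻¹ * dist (c : ℂ) z := by
    intro z
    have hc0' : (c : ℂ) ≠ 0 := by exact_mod_cast hc0
    rw [hcinv, ← abs_inv, ← Real.norm_eq_abs, ← Complex.norm_real, dist_eq_norm, ← norm_mul]
    congr 1
    push_cast
    field_simp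
  have hcp : 0 < |c| := abs_pos.2 hc0
  rw [Metric.mem_closure_iff]
  have : Nonempty (ℝ × {ω : ℂ // 0 < ω.re}) := ⟨(0, ⟨1, by simp⟩)⟩
  constructor
  · intro h ε hε
    -- The bound 1 rules out `X = 0`, where the Laplace transform vanishes and the norm equals 1.
    have hlt : penroseInf P p q < min 1 (|c|⁻¹ * ε) := by
      rw [h]
      positivity
    obtain ⟨⟨X, ω, hω⟩, hlt⟩ := exists_lt_of_ciInf_lt hlt
    have hX : X ≠ 0 := by
      rintro rfl
      have := hlt.trans_le (min_le_left _ _)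
      simp [kernelLaplace_zero] at this
    obtain ⟨Ω, hΩ, heq⟩ := exists_norm_one_sub_kernelLaplace_eq P hp q hX hω
    refine ⟨_, ⟨X, Ω, hX, hΩ, rfl⟩, ?_⟩
    have h2 := hlt.trans_le (min_le_right _ _)
    simp only [] at h2
    rw [heq, hdist] at h2
    exact lt_of_mul_lt_mul_left h2 (by positivity)
  · intro h
    refine le_antisymm (le_of_forall_pos_lt_add fun ε hε => ?_) (penroseInf_nonneg P p q)
    obtain ⟨z, ⟨X, Ω, hX, hΩ, rfl⟩, hz⟩ := h (|c| * ε) (by positivity)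
    obtain ⟨X', ω, hω, heq⟩ := exists_kernelLaplace_eq P hp q hX hΩ
    have hbdd : BddBelow (Set.range fun z : ℝ × {ω : ℂ // 0 < ω.re} =>
        ‖1 - kernelLaplace P p q z.1 z.2‖) := ⟨0, by rintro _ ⟨z, rfl⟩; positivity⟩
    refine (ciInf_le hbdd (X', ⟨ω, hω⟩)).trans_lt ?_
    dsimp only
    rw [heq, hdist, zero_add, inv_mul_lt_iff₀ hcp]
    exact hz

/-! ### An argument principle on the unit disc -/

/-- Maximum modulus principle for `exp(-F)`, whose modulus is `exp(-Re F)`. -/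
lemma re_pos_of_re_pos_sphere {F : ℂ → ℂ} (hc : ContinuousOn F (Metric.closedBall 0 1))
    (hd : DifferentiableOn ℂ F (Metric.ball 0 1)) (h : ∀ w ∈ Metric.sphere (0 : ℂ) 1, 0 < (F w).re)
    {w : ℂ} (hw : w ∈ Metric.closedBall (0 : ℂ) 1) : 0 < (F w).re := by
  obtain ⟨w₀, hw₀, hmin⟩ := (isCompact_sphere (0 : ℂ) 1).exists_isMinOn
    (NormedSpace.sphere_nonempty.2 zero_le_one)
    (Complex.continuous_re.comp_continuousOn (hc.mono Metric.sphere_subset_closedBall))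
  have hdc : DiffContOnCl ℂ (fun w => Complex.exp (-F w)) (Metric.ball 0 1) := by
    refine ⟨hd.neg.cexp, ?_⟩
    rw [closure_ball _ one_ne_zero]
    exact hc.neg.cexp
  have := Complex.norm_le_of_forall_mem_frontier_norm_le Metric.isBounded_ball hdc
    (C := Real.exp (-(F w₀).re)) (fun z hz => ?_) (z := w)
    (by rwa [closure_ball _ one_ne_zero])
  · rw [Complex.norm_exp, Real.exp_le_exp, Complex.neg_re, neg_le_neg_iff] at this
    exact (h w₀ hw₀).trans_le this
  · rw [frontier_ball _ one_ne_zero] at hz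
    rw [Complex.norm_exp, Real.exp_le_exp, Complex.neg_re, neg_le_neg_iff]
    exact hmin hz

/-- The standard parametrization of the unit circle by `ℝ / ℤ`. -/
noncomputable def unitExp (s : ℝ) : ℂ := Complex.exp (2 * Real.pi * Complex.I * s)

lemma continuous_unitExp : Continuous unitExp := by
  unfold unitExp
  fun_prop

lemma norm_unitExp (s : ℝ) : ‖unitExp s‖ = 1 := by
  have : (2 * Real.pi * Complex.I * s : ℂ) = ((2 * Real.pi * s : ℝ) : ℂ) * Complex.I := by
    push_cast
    ring
  rw [unitExp, this, Complex.norm_exp_ofReal_mul_I]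

lemma unitExp_ne_zero (s : ℝ) : unitExp s ≠ 0 := Complex.exp_ne_zero _

lemma unitExp_zpow (s : ℝ) (n : ℤ) :
    unitExp s ^ n = Complex.exp (2 * Real.pi * Complex.I * n * s) := by
  rw [unitExp, ← Complex.exp_int_mul]
  congr 1
  ring

lemma unitExp_add_intCast (s : ℝ) (n : ℤ) : unitExp (s + n) = unitExp s := by
  rw [unitExp, unitExp]
  have : (2 * Real.pi * Complex.I * ((s + n : ℝ) : ℂ) : ℂ) =
      2 * Real.pi * Complex.I * s + n * (2 * Real.pi * Complex.I) := by
    push_cast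
    ring
  rw [this, Complex.exp_add, Complex.exp_int_mul_two_pi_mul_I, mul_one]

lemma unitExp_zero : unitExp 0 = 1 := by simp [unitExp]

lemma unitExp_one : unitExp 1 = 1 := by
  simpa [unitExp_zero] using unitExp_add_intCast 0 1

lemma exists_unitExp_eq {w : ℂ} (hw : w ∈ Metric.sphere (0 : ℂ) 1) : ∃ s : ℝ, unitExp s = w := by
  refine ⟨w.arg / (2 * Real.pi), ?_⟩
  have hn : ‖w‖ = 1 := by simpa using hw
  have hpi : (Real.pi : ℂ) ≠ 0 := by exact_mod_cast Real.pi_ne_zero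
  have h := Complex.norm_mul_exp_arg_mul_I w
  rw [hn, Complex.ofReal_one, one_mul] at h
  rw [unitExp, ← h]
  congr 1
  rw [h]
  push_cast
  field_simp

/-- Nonnegative frequencies are powers of `w`; on the circle negative ones are conjugates of powers.
-/
lemma exists_entire_of_mem_span_fourier {f : C(AddCircle (1 : ℝ), ℂ)}
    (hf : f ∈ Submodule.span ℂ (Set.range (@fourier (1 : ℝ)))) :
    ∃ A B : ℂ → ℂ, Differentiable ℂ A ∧ Differentiable ℂ B ∧
      ∀ s : ℝ, f s = A (unitExp s) + conj (B (unitExp s)) := by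
  induction hf using Submodule.span_induction with
  | mem f h =>
    obtain ⟨n, rfl⟩ := h
    have hf : ∀ s : ℝ, fourier n (s : AddCircle (1 : ℝ)) = unitExp s ^ n := fun s => by
      rw [fourier_coe_apply, unitExp_zpow]
      simp
    rcases Int.le_total 0 n with hn | hn
    · lift n to ℕ using hn
      refine ⟨fun w => w ^ n, fun _ => 0, by fun_prop, by fun_prop, fun s => ?_⟩
      rw [hf]
      simp
    · obtain ⟨m, rfl⟩ : ∃ m : ℕ, n = -m := ⟨(-n).toNat, by omega⟩
      refine ⟨fun _ => 0, fun w => w ^ m, by fun_prop, by fun_prop, fun s => ?_⟩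
      rw [hf, zpow_neg, zpow_natCast, zero_add, map_pow, ← inv_pow,
        Complex.inv_eq_conj (norm_unitExp s)]
  | zero => exact ⟨fun _ => 0, fun _ => 0, by fun_prop, by fun_prop, by simp⟩
  | add f g _ _ hf hg =>
    obtain ⟨A, B, hA, hB, h⟩ := hf
    obtain ⟨A', B', hA', hB', h'⟩ := hg
    refine ⟨fun w => A w + A' w, fun w => B w + B' w, by fun_prop, by fun_prop, fun s => ?_⟩
    rw [ContinuousMap.add_apply, h, h', map_add]
    ring
  | smul c f _ hf =>
    obtain ⟨A, B, hA, hB, h⟩ := hf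
    refine ⟨fun w => c * A w, fun w => conj c * B w, by fun_prop, by fun_prop, fun s => ?_⟩
    rw [ContinuousMap.smul_apply, h, map_mul, Complex.conj_conj, smul_eq_mul]
    ring

/-- The exponential of a continuous function on the circle can be moved into the right half-plane
by a factor which is the exponential of an entire function. -/
lemma exists_entire_re_exp_pos (f : C(AddCircle (1 : ℝ), ℂ)) :
    ∃ H : ℂ → ℂ, Differentiable ℂ H ∧ ∀ s : ℝ, 0 < (Complex.exp (f s + H (unitExp s))).re := by
  have hf : f ∈ (Submodule.span ℂ (Set.range (@fourier (1 : ℝ)))).topologicalClosure := by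
    have : Fact (0 < (1 : ℝ)) := ⟨one_pos⟩
    rw [span_fourier_closure_eq_top]
    trivial
  obtain ⟨g, hg, hfg⟩ := Metric.mem_closure_iff.1 hf 1 one_pos
  obtain ⟨A, B, hA, hB, h⟩ := exists_entire_of_mem_span_fourier hg
  -- If `f` is within 1 of `A + conj B`, then adding `B - A` leaves `f - g` plus the real number `B
  -- + conj B`. The imaginary part is then below `1 < π/2`, so the exponential has positive real
  -- part.
  refine ⟨fun w => B w - A w, by fun_prop, fun s => ?_⟩
  have hδ : ‖f s - g s‖ < 1 := by
    rw [dist_eq_norm] at hfg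
    exact (ContinuousMap.norm_coe_le_norm (f - g) s).trans_lt hfg
  have him : (f s + (B (unitExp s) - A (unitExp s))).im = (f s - g s).im := by
    rw [h]
    simp
    ring
  rw [Complex.exp_re, him]
  have h1 := (Complex.abs_im_le_norm (f s - g s)).trans_lt hδ
  have h2 := Real.pi_gt_three
  rw [abs_lt] at h1
  exact mul_pos (Real.exp_pos _) (Real.cos_pos_of_mem_Ioo ⟨by linarith, by linarith⟩)

lemma ne_zero_of_eq_exp_on_circle {f : ℂ → ℂ} (hc : ContinuousOn f (Metric.closedBall 0 1))
    (hd : DifferentiableOn ℂ f (Metric.ball 0 1)) (l : C(AddCircle (1 : ℝ), ℂ))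
    (h : ∀ s : ℝ, f (unitExp s) = Complex.exp (l s)) {w : ℂ}
    (hw : w ∈ Metric.closedBall (0 : ℂ) 1) : f w ≠ 0 := by
  obtain ⟨H, hH, hpos⟩ := exists_entire_re_exp_pos l
  have := re_pos_of_re_pos_sphere (F := fun w => f w * Complex.exp (H w))
    (hc.mul hH.continuous.cexp.continuousOn) (hd.mul hH.cexp.differentiableOn) (fun w hw => ?_) hw
  · rintro h0
    simp [h0] at this
  · obtain ⟨s, rfl⟩ := exists_unitExp_eq hw
    rw [h, ← Complex.exp_add]
    exact hpos s

/-- For `n ≠ 0`, multiplying `f exp(H)`, or its reciprocal, by `w^|n|` cancels the winding. The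
result has positive real part on the circle, hence at 0, yet it vanishes there. -/
lemma eq_zero_of_eq_exp_mul_zpow_on_circle {f : ℂ → ℂ}
    (hc : ContinuousOn f (Metric.closedBall 0 1)) (hd : DifferentiableOn ℂ f (Metric.ball 0 1))
    (l : C(AddCircle (1 : ℝ), ℂ)) {n : ℤ}
    (h : ∀ s : ℝ, f (unitExp s) = Complex.exp (l s) * unitExp s ^ n)
    (hf : ∀ w ∈ Metric.closedBall (0 : ℂ) 1, f w ≠ 0) : n = 0 := by
  obtain ⟨H, hH, hpos⟩ := exists_entire_re_exp_pos l
  have h0 : (0 : ℂ) ∈ Metric.closedBall (0 : ℂ) 1 := by simp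
  by_contra hn
  rcases lt_or_gt_of_ne hn with hn | hn
  · obtain ⟨m, rfl⟩ : ∃ m : ℕ, n = -m := ⟨(-n).toNat, by omega⟩
    have := re_pos_of_re_pos_sphere (F := fun w => w ^ m * (f w * Complex.exp (H w)))
      ((by fun_prop : Continuous fun w : ℂ => w ^ m).continuousOn.mul
        (hc.mul hH.continuous.cexp.continuousOn))
      ((by fun_prop : Differentiable ℂ fun w : ℂ => w ^ m).differentiableOn.mul
        (hd.mul hH.cexp.differentiableOn)) (fun w hw => ?_) h0
    · simp [show m ≠ 0 by omega] at this
    · obtain ⟨s, rfl⟩ := exists_unitExp_eq hw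
      have hne := pow_ne_zero m (unitExp_ne_zero s)
      rw [h, zpow_neg, zpow_natCast]
      convert hpos s using 2
      rw [Complex.exp_add]
      field_simp
  · lift n to ℕ using hn.le
    have hne : ∀ w ∈ Metric.closedBall (0 : ℂ) 1, f w * Complex.exp (H w) ≠ 0 := fun w hw =>
      mul_ne_zero (hf w hw) (Complex.exp_ne_zero _)
    have := re_pos_of_re_pos_sphere (F := fun w => w ^ n / (f w * Complex.exp (H w)))
      ((by fun_prop : Continuous fun w : ℂ => w ^ n).continuousOn.div
        (hc.mul hH.continuous.cexp.continuousOn) hne)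
      ((by fun_prop : Differentiable ℂ fun w : ℂ => w ^ n).differentiableOn.div
        (hd.mul hH.cexp.differentiableOn) fun w hw => hne w (Metric.ball_subset_closedBall hw))
      (fun w hw => ?_) h0
    · simp [show n ≠ 0 by omega] at this
    · obtain ⟨s, rfl⟩ := exists_unitExp_eq hw
      have hne := pow_ne_zero n (unitExp_ne_zero s)
      have : unitExp s ^ n / (f (unitExp s) * Complex.exp (H (unitExp s))) =
          (Complex.exp (l s + H (unitExp s)))⁻¹ := by
        rw [h, zpow_natCast, Complex.exp_add]
        field_simp
      rw [this, Complex.inv_re]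
      exact div_pos (hpos s) (Complex.normSq_pos.2 (Complex.exp_ne_zero _))

/-! ### Transfer to the upper half-plane and winding numbers -/

/-- The Cayley transform from the unit disc to the upper half-plane. -/
noncomputable def cayley (w : ℂ) : ℂ := Complex.I * (1 + w) / (1 - w)

lemma cayley_im (w : ℂ) : (cayley w).im = (1 - ‖w‖ ^ 2) / Complex.normSq (1 - w) := by
  rw [cayley, mul_div_assoc, Complex.I_mul_im, Complex.div_re, ← Complex.normSq_eq_norm_sq,
    Complex.normSq_apply w]
  simp
  ring

lemma cayley_im_nonneg {w : ℂ} (hw : w ∈ Metric.closedBall (0 : ℂ) 1) : 0 ≤ (cayley w).im := by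
  rw [cayley_im]
  rw [mem_closedBall_zero_iff] at hw
  exact div_nonneg (by nlinarith [norm_nonneg w]) (Complex.normSq_nonneg _)

lemma cayley_im_pos {w : ℂ} (hw : w ∈ Metric.ball (0 : ℂ) 1) : 0 < (cayley w).im := by
  rw [cayley_im]
  rw [mem_ball_zero_iff] at hw
  refine div_pos (by nlinarith [norm_nonneg w]) (Complex.normSq_pos.2 (sub_ne_zero.2 ?_))
  rintro rfl
  simp at hw

lemma exists_cayley_eq {Ω : ℂ} (hΩ : 0 < Ω.im) : ∃ w ∈ Metric.ball (0 : ℂ) 1, cayley w = Ω := by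
  have hne : Ω + Complex.I ≠ 0 := fun h => by
    have := congrArg Complex.im h
    simp at this
    linarith
  refine ⟨(Ω - Complex.I) / (Ω + Complex.I), ?_, ?_⟩
  · rw [mem_ball_zero_iff, norm_div, div_lt_one (norm_pos_iff.2 hne),
      ← sq_lt_sq₀ (norm_nonneg _) (norm_nonneg _), ← Complex.normSq_eq_norm_sq,
      ← Complex.normSq_eq_norm_sq, Complex.normSq_apply, Complex.normSq_apply]
    simp
    nlinarith
  · have h1 : 1 + (Ω - Complex.I) / (Ω + Complex.I) = 2 * Ω / (Ω + Complex.I) := by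
      field_simp
      ring
    have h2 : 1 - (Ω - Complex.I) / (Ω + Complex.I) = 2 * Complex.I / (Ω + Complex.I) := by
      field_simp
      ring
    have := Complex.I_ne_zero
    rw [cayley, h1, h2]
    field_simp

lemma cayley_unitExp {s : ℝ} (hs : s ∈ Set.Ioo (0 : ℝ) 1) :
    cayley (unitExp s) = (Real.tan (Real.pi * s - Real.pi / 2) : ℂ) ∧ unitExp s ≠ 1 := by
  have hsin : Real.sin (Real.pi * s) ≠ 0 := by
    refine (Real.sin_pos_of_pos_of_lt_pi (mul_pos Real.pi_pos hs.1) ?_).ne'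
    nlinarith [hs.2, Real.pi_pos]
  set z : ℂ := Complex.exp (Real.pi * s * Complex.I) with hzdef
  have hz : z ≠ 0 := Complex.exp_ne_zero _
  have he : unitExp s = z ^ 2 := by
    rw [unitExp, ← Complex.exp_nat_mul]
    congr 1
    push_cast
    ring
  have hz' : Complex.exp (-(Real.pi * s) * Complex.I) = z⁻¹ := by
    rw [neg_mul, Complex.exp_neg]
  have hsin' : Complex.sin (Real.pi * s) ≠ 0 := by exact_mod_cast hsin
  have hs1 : 1 - z ^ 2 = -2 * Complex.I * z * Complex.sin (Real.pi * s) := by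
    rw [Complex.sin, hz', ← hzdef]
    field_simp
    linear_combination (1 - z ^ 2) * Complex.I_sq
  have hc1 : 1 + z ^ 2 = 2 * z * Complex.cos (Real.pi * s) := by
    rw [Complex.cos, hz', ← hzdef]
    field_simp
    ring
  have := Complex.I_ne_zero
  constructor
  · rw [Real.tan_eq_sin_div_cos, Real.sin_sub_pi_div_two, Real.cos_sub_pi_div_two, cayley, he, hs1,
      hc1]
    push_cast
    field_simp
  · rw [he]
    intro h
    rw [h, sub_self] at hs1
    simp [hz, hsin'] at hs1

/-- Transplantation to the closed unit disc of a function on the closed upper half-plane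
vanishing at infinity. -/
noncomputable def discFun (F : ℂ → ℂ) (w : ℂ) : ℂ := if w = 1 then 0 else F (cayley w)

lemma discFun_one (F : ℂ → ℂ) : discFun F 1 = 0 := by simp [discFun]

lemma discFun_of_ne (F : ℂ → ℂ) {w : ℂ} (hw : w ≠ 1) : discFun F w = F (cayley w) := by
  simp [discFun, hw]

lemma discFun_unitExp (F : ℂ → ℂ) {s : ℝ} (hs : s ∈ Set.Ioo (0 : ℝ) 1) :
    discFun F (unitExp s) = F (Real.tan (Real.pi * s - Real.pi / 2) : ℝ) := by
  rw [discFun_of_ne F (cayley_unitExp hs).2, (cayley_unitExp hs).1]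

lemma continuousAt_cayley {w : ℂ} (hw : w ≠ 1) : ContinuousAt cayley w := by
  unfold cayley
  have : 1 - w ≠ 0 := sub_ne_zero.2 hw.symm
  fun_prop (disch := assumption)

/-- Functions continuous on the closed upper half-plane, holomorphic in its interior and
`O(1/|Ω|)` at infinity. -/
structure IsHardyLike (F : ℂ → ℂ) : Prop where
  continuousOn : ContinuousOn F {Ω | 0 ≤ Ω.im}
  differentiableOn : DifferentiableOn ℂ F {Ω | 0 < Ω.im}
  decay : ∃ C : ℝ, 0 ≤ C ∧ ∀ Ω : ℂ, 0 ≤ Ω.im → ‖Ω‖ * ‖F Ω‖ ≤ C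

lemma IsHardyLike.continuousOn_discFun {F : ℂ → ℂ} (hF : IsHardyLike F) :
    ContinuousOn (discFun F) (Metric.closedBall 0 1) := by
  intro w hw
  by_cases h1 : w = 1
  · subst h1
    obtain ⟨C, hC0, hC⟩ := hF.decay
    rw [ContinuousWithinAt, discFun_one]
    have hlim : Tendsto (fun w : ℂ => C * ‖1 - w‖ / ‖1 + w‖)
        (𝓝[Metric.closedBall 0 1] 1) (𝓝 0) := by
      have hcont : ContinuousAt (fun w : ℂ => C * ‖1 - w‖ / ‖1 + w‖) 1 := by
        have : ‖(1 : ℂ) + 1‖ ≠ 0 := by norm_num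
        fun_prop (disch := assumption)
      simpa using hcont.tendsto.mono_left nhdsWithin_le_nhds
    refine squeeze_zero_norm' ?_ hlim
    have hne : ∀ᶠ w : ℂ in 𝓝[Metric.closedBall 0 1] 1, 1 + w ≠ 0 := by
      refine nhdsWithin_le_nhds (ContinuousAt.eventually_ne (by fun_prop) (by norm_num))
    filter_upwards [self_mem_nhdsWithin, hne] with w hw hw2
    by_cases h : w = 1
    · rw [h, discFun_one]
      simp
    · rw [discFun_of_ne F h]
      have := hC _ (cayley_im_nonneg hw)
      have h3 : 0 < ‖1 - w‖ := norm_pos_iff.2 (sub_ne_zero.2 (Ne.symm h))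
      have h4 : 0 < ‖1 + w‖ := norm_pos_iff.2 hw2
      have h5 : ‖cayley w‖ = ‖1 + w‖ / ‖1 - w‖ := by simp [cayley]
      rw [h5, div_mul_eq_mul_div, div_le_iff₀ h3] at this
      rw [le_div_iff₀ h4]
      linarith
  · have hcomp : ContinuousWithinAt (fun w => F (cayley w)) (Metric.closedBall 0 1) w :=
      (hF.continuousOn _ (cayley_im_nonneg hw)).comp (continuousAt_cayley h1).continuousWithinAt
        fun _ h => cayley_im_nonneg h
    refine hcomp.congr_of_eventuallyEq ?_ (discFun_of_ne F h1)
    filter_upwards [nhdsWithin_le_nhds (isOpen_ne.mem_nhds h1)] with v hv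
    exact discFun_of_ne F hv

lemma IsHardyLike.differentiableOn_discFun {F : ℂ → ℂ} (hF : IsHardyLike F) :
    DifferentiableOn ℂ (discFun F) (Metric.ball 0 1) := by
  have hne : ∀ w ∈ Metric.ball (0 : ℂ) 1, w ≠ 1 := by
    rintro w hw rfl
    simp at hw
  have h : DifferentiableOn ℂ (fun w => F (cayley w)) (Metric.ball 0 1) := by
    refine hF.differentiableOn.comp (fun w hw => ?_) fun w hw => cayley_im_pos hw
    have : 1 - w ≠ 0 := sub_ne_zero.2 (hne w hw).symm
    unfold cayley
    exact DifferentiableAt.differentiableWithinAt (by fun_prop (disch := assumption))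
  exact h.congr fun w hw => discFun_of_ne F (hne w hw)

lemma IsHardyLike.tendsto_zero {F : ℂ → ℂ} (hF : IsHardyLike F) {α : Type*} {l : Filter α}
    {g : α → ℂ} (him : ∀ᶠ a in l, 0 ≤ (g a).im) (hg : Tendsto (fun a => ‖g a‖) l atTop) :
    Tendsto (fun a => F (g a)) l (𝓝 0) := by
  obtain ⟨C, hC0, hC⟩ := hF.decay
  refine squeeze_zero_norm' ?_ (hg.const_div_atTop C)
  filter_upwards [him, hg.eventually_gt_atTop 0] with a ha ha0
  rw [le_div_iff₀ ha0, mul_comm]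
  exact hC _ ha

lemma IsHardyLike.tendsto_atTop {F : ℂ → ℂ} (hF : IsHardyLike F) :
    Tendsto (fun t : ℝ => F t) atTop (𝓝 0) := by
  refine hF.tendsto_zero (Eventually.of_forall fun t => by simp) ?_
  simpa using tendsto_abs_atTop_atTop

lemma IsHardyLike.tendsto_atBot {F : ℂ → ℂ} (hF : IsHardyLike F) :
    Tendsto (fun t : ℝ => F t) atBot (𝓝 0) := by
  refine hF.tendsto_zero (Eventually.of_forall fun t => by simp) ?_
  simpa using tendsto_abs_atBot_atTop

lemma tendsto_tan_shift_zero :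
    Tendsto (fun s : ℝ => Real.tan (Real.pi * s - Real.pi / 2)) (𝓝[>] 0) atBot := by
  refine Real.tendsto_tan_neg_pi_div_two.comp (tendsto_nhdsWithin_iff.2 ⟨?_, ?_⟩)
  · have : Continuous fun s : ℝ => Real.pi * s - Real.pi / 2 := by fun_prop
    simpa using (this.tendsto 0).mono_left (nhdsWithin_le_nhds (s := Set.Ioi 0))
  · filter_upwards [self_mem_nhdsWithin] with s (hs : 0 < s)
    have := mul_pos Real.pi_pos hs
    simp only [Set.mem_Ioi]
    linarith

lemma tendsto_tan_shift_one :
    Tendsto (fun s : ℝ => Real.tan (Real.pi * s - Real.pi / 2)) (𝓝[<] 1) atTop := by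
  refine Real.tendsto_tan_pi_div_two.comp (tendsto_nhdsWithin_iff.2 ⟨?_, ?_⟩)
  · have : Continuous fun s : ℝ => Real.pi * s - Real.pi / 2 := by fun_prop
    have h := (this.tendsto 1).mono_left (nhdsWithin_le_nhds (s := Set.Iio 1))
    have e : Real.pi * 1 - Real.pi / 2 = Real.pi / 2 := by ring
    rwa [e] at h
  · filter_upwards [self_mem_nhdsWithin] with s (hs : s < 1)
    have := mul_lt_mul_of_pos_left hs Real.pi_pos
    simp only [Set.mem_Iio]
    linarith

lemma continuousOn_tan_shift :
    ContinuousOn (fun s : ℝ => Real.tan (Real.pi * s - Real.pi / 2)) (Set.Ioo 0 1) := by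
  intro s hs
  refine ContinuousAt.continuousWithinAt ?_
  refine ContinuousAt.comp (g := Real.tan) (Real.continuousAt_tan.2 ?_) (by fun_prop)
  rw [Real.cos_sub_pi_div_two]
  refine (Real.sin_pos_of_pos_of_lt_pi (mul_pos Real.pi_pos hs.1) ?_).ne'
  nlinarith [hs.2, Real.pi_pos]

lemma IsHardyLike.exists_circle_log {F : ℂ → ℂ} (hF : IsHardyLike F) {z : ℂ} {n : ℤ}
    (h : HasWindingNumber (fun t : ℝ => F t) z n) :
    ∃ l : C(AddCircle (1 : ℝ), ℂ),
      ∀ s : ℝ, discFun F (unitExp s) - z = Complex.exp (l s) * unitExp s ^ n := by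
  obtain ⟨L, hLc, hL, a, hbot, htop⟩ := h
  -- The curve tends to 0 at both ends, which fixes the value at the point `w = 1` corresponding to
  -- infinity.
  have hea : Complex.exp a = -z := by
    have h1 := (Complex.continuous_exp.tendsto a).comp hbot
    have h2 := (hF.tendsto_atBot.sub_const z).congr hL
    rw [zero_sub] at h2
    exact tendsto_nhds_unique h1 h2
  -- Subtracting `2πins` removes the increment of the logarithm, so both ends have limit `a` and the
  -- function closes up on the circle.
  set m₀ : ℝ → ℂ := fun s =>
    L (Real.tan (Real.pi * s - Real.pi / 2)) - 2 * Real.pi * Complex.I * n * s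
  have hlin : Continuous fun s : ℝ => (2 * Real.pi * Complex.I * n * s : ℂ) := by fun_prop
  have hm0 : Tendsto m₀ (𝓝[>] 0) (𝓝 a) := by
    have h1 := hbot.comp tendsto_tan_shift_zero
    have h2 := (hlin.tendsto 0).mono_left (nhdsWithin_le_nhds (s := Set.Ioi 0))
    simpa [m₀] using h1.sub h2
  have hm1 : Tendsto m₀ (𝓝[<] 1) (𝓝 a) := by
    have h1 := htop.comp tendsto_tan_shift_one
    have h2 := (hlin.tendsto 1).mono_left (nhdsWithin_le_nhds (s := Set.Iio 1))
    simpa [m₀] using h1.sub h2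
  have hmc : ContinuousOn m₀ (Set.Ioo 0 1) :=
    (hLc.comp_continuousOn continuousOn_tan_shift).sub hlin.continuousOn
  set m : ℝ → ℂ := extendFrom (Set.Ioo 0 1) m₀
  have hmC : ContinuousOn m (Set.Icc 0 1) := continuousOn_Icc_extendFrom_Ioo hmc hm0 hm1
  have hma : m 0 = a := eq_lim_at_left_extendFrom_Ioo one_pos hm0
  have hmb : m 1 = a := eq_lim_at_right_extendFrom_Ioo one_pos hm1
  have : Fact (0 < (1 : ℝ)) := ⟨one_pos⟩
  refine ⟨⟨AddCircle.liftIco 1 0 m, AddCircle.liftIco_zero_continuous (hma.trans hmb.symm) hmC⟩,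
    fun s => ?_⟩
  have hfr : unitExp s = unitExp (Int.fract s) := by
    conv_lhs => rw [← Int.fract_add_floor s]
    exact unitExp_add_intCast _ _
  have hco : (s : AddCircle (1 : ℝ)) = (Int.fract s : ℝ) := by
    rw [← sub_eq_zero, ← AddCircle.coe_sub, Int.self_sub_fract]
    exact (AddCircle.coe_eq_zero_iff 1).2 ⟨⌊s⌋, by simp⟩
  rw [hfr, hco, ContinuousMap.coe_mk, AddCircle.liftIco_zero_coe_apply
    ⟨Int.fract_nonneg s, Int.fract_lt_one s⟩]
  rcases (Int.fract_nonneg s).eq_or_lt with h0 | h0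
  · rw [← h0, hma, hea, unitExp_zero, discFun_one]
    simp
  · have hs : Int.fract s ∈ Set.Ioo (0 : ℝ) 1 := ⟨h0, Int.fract_lt_one s⟩
    have hmm : m (Int.fract s) = m₀ (Int.fract s) := by
      refine extendFrom_eq (subset_closure hs) (hmc _ hs)
    rw [discFun_unitExp F hs, hL, hmm, unitExp_zpow, ← Complex.exp_add]
    congr 1
    simp [m₀]

/-- The closed loop `discFun F - z` avoids 0, at the point of infinity because `z ≠ 0`, and so lifts
through the covering `exp`. The two end values of the lift differ by a multiple of `2πi`. -/
lemma IsHardyLike.exists_hasWindingNumber {F : ℂ → ℂ} (hF : IsHardyLike F) {z : ℂ} (hz : z ≠ 0)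
    (hne : ∀ t : ℝ, F t ≠ z) : ∃ n : ℤ, HasWindingNumber (fun t : ℝ => F t) z n := by
  have hcont : Continuous fun s : ℝ => discFun F (unitExp s) - z := by
    refine Continuous.sub ?_ continuous_const
    refine hF.continuousOn_discFun.comp_continuous continuous_unitExp fun s => ?_
    rw [mem_closedBall_zero_iff, norm_unitExp]
  have hne0 : ∀ s : unitInterval, discFun F (unitExp s) - z ≠ 0 := by
    rintro ⟨s, hs0, hs1⟩
    rcases hs0.eq_or_lt with rfl | hs0
    · simpa [unitExp_zero, discFun_one] using hz
    rcases hs1.eq_or_lt with rfl | hs1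
    · simpa [unitExp_one, discFun_one] using hz
    simp only
    rw [discFun_unitExp F ⟨hs0, hs1⟩]
    exact sub_ne_zero.2 (hne _)
  let γ : C(unitInterval, {z : ℂ // z ≠ 0}) :=
    ⟨fun s => ⟨discFun F (unitExp s) - z, hne0 s⟩,
      (hcont.comp continuous_subtype_val).subtype_mk _⟩
  obtain ⟨Γ, hΓ, -⟩ := Complex.isCoveringMap_exp.exists_path_lifts γ (Complex.log (-z)) (by
    ext
    simp [γ, unitExp_zero, discFun_one, Complex.exp_log (neg_ne_zero.2 hz)])
  have hΓ' : ∀ s : unitInterval, Complex.exp (Γ s) = discFun F (unitExp s) - z := fun s =>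
    congrArg Subtype.val (congrFun hΓ s)
  have h0 : Complex.exp (Γ 0) = -z := by simp [hΓ', unitExp_zero, discFun_one]
  have h1 : Complex.exp (Γ 1) = -z := by simp [hΓ', unitExp_one, discFun_one]
  obtain ⟨n, hn⟩ := Complex.exp_eq_exp_iff_exists_int.1 (h1.trans h0.symm)
  set σ : ℝ → ℝ := fun t => 1 / 2 + Real.arctan t / Real.pi
  have hσ : ∀ t, σ t ∈ Set.Ioo (0 : ℝ) 1 := fun t => by
    have hpi := Real.pi_pos
    have a1 := Real.neg_pi_div_two_lt_arctan t
    have a2 := Real.arctan_lt_pi_div_two t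
    have b1 : -(1 / 2) < Real.arctan t / Real.pi := by rw [lt_div_iff₀ hpi]; linarith
    have b2 : Real.arctan t / Real.pi < 1 / 2 := by rw [div_lt_iff₀ hpi]; linarith
    exact ⟨by simp only [σ]; linarith, by simp only [σ]; linarith⟩
  have hΓe : Continuous fun s : ℝ => Γ (Set.projIcc 0 1 zero_le_one s) :=
    Γ.continuous.comp continuous_projIcc
  have hσc : Continuous σ := by
    have := Real.continuous_arctan
    fun_prop
  have hpi := Real.pi_ne_zero
  have hσbot : Tendsto σ atBot (𝓝 0) := by
    have := ((Real.tendsto_arctan_atBot.mono_right nhdsWithin_le_nhds).div_const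
      Real.pi).const_add (1 / 2)
    convert this using 2
    field_simp
    norm_num
  have hσtop : Tendsto σ atTop (𝓝 1) := by
    have := ((Real.tendsto_arctan_atTop.mono_right nhdsWithin_le_nhds).div_const
      Real.pi).const_add (1 / 2)
    convert this using 2
    field_simp
    norm_num
  refine ⟨n, fun t => Γ (Set.projIcc 0 1 zero_le_one (σ t)), hΓe.comp hσc, fun t => ?_, Γ 0,
    ?_, ?_⟩
  · rw [hΓ', Set.projIcc_of_mem _ ⟨(hσ t).1.le, (hσ t).2.le⟩, discFun_unitExp F (hσ t)]
    have : Real.pi * σ t - Real.pi / 2 = Real.arctan t := by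
      simp only [σ]
      field_simp
      ring
    rw [this, Real.tan_arctan]
  · have := (hΓe.tendsto 0).comp hσbot
    rw [Set.projIcc_left] at this
    exact this
  · have := (hΓe.tendsto 1).comp hσtop
    rw [Set.projIcc_right] at this
    have e : Γ 0 + 2 * Real.pi * Complex.I * n = Γ 1 := by rw [hn]; ring
    rw [e]
    exact this

lemma IsHardyLike.ne_of_hasWindingNumber_zero {F : ℂ → ℂ} (hF : IsHardyLike F) {z : ℂ}
    (h : HasWindingNumber (fun t : ℝ => F t) z 0) {Ω : ℂ} (hΩ : 0 < Ω.im) : F Ω ≠ z := by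
  obtain ⟨l, hl⟩ := hF.exists_circle_log h
  obtain ⟨w, hw, rfl⟩ := exists_cayley_eq hΩ
  have := ne_zero_of_eq_exp_on_circle (f := fun w => discFun F w - z)
    (hF.continuousOn_discFun.sub continuousOn_const)
    (hF.differentiableOn_discFun.sub (differentiableOn_const _)) l (by simpa using hl)
    (Metric.ball_subset_closedBall hw)
  rw [discFun_of_ne F (by rintro rfl; simp at hw)] at this
  exact sub_ne_zero.1 this

lemma IsHardyLike.exists_eq_of_hasWindingNumber {F : ℂ → ℂ} (hF : IsHardyLike F) {z : ℂ}
    (hz : z ≠ 0) (hne : ∀ t : ℝ, F t ≠ z) {n : ℤ} (hn : n ≠ 0)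
    (h : HasWindingNumber (fun t : ℝ => F t) z n) : ∃ Ω : ℂ, 0 < Ω.im ∧ F Ω = z := by
  obtain ⟨l, hl⟩ := hF.exists_circle_log h
  by_contra! hno
  refine hn (eq_zero_of_eq_exp_mul_zpow_on_circle (f := fun w => discFun F w - z)
    (hF.continuousOn_discFun.sub continuousOn_const)
    (hF.differentiableOn_discFun.sub (differentiableOn_const _)) l hl fun w hw => ?_)
  by_cases hw1 : w = 1
  · simpa [hw1, discFun_one] using hz
  · rw [discFun_of_ne F hw1]
    refine sub_ne_zero.2 ?_
    rcases (cayley_im_nonneg hw).eq_or_lt with h0 | h0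
    · have : cayley w = ((cayley w).re : ℂ) := Complex.ext (by simp) (by simp [← h0])
      rw [this]
      exact hne _
    · exact hno _ h0

lemma IsHardyLike.exists_hasWindingNumber_ne_zero {F : ℂ → ℂ} (hF : IsHardyLike F) {z : ℂ}
    (hz : z ≠ 0) (hne : ∀ t : ℝ, F t ≠ z) {Ω : ℂ} (hΩ : 0 < Ω.im) (hFΩ : F Ω = z) :
    ∃ n : ℤ, n ≠ 0 ∧ HasWindingNumber (fun t : ℝ => F t) z n := by
  obtain ⟨n, hn⟩ := hF.exists_hasWindingNumber hz hne
  refine ⟨n, ?_, hn⟩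
  rintro rfl
  exact hF.ne_of_hasWindingNumber_zero hn hΩ hFΩ

/-! ### Attained values, enclosed points and the stability criterion -/

lemma isHardyLike_halfPlaneExt (Q : 𝓢(ℝ, ℂ)) (X : ℝ) : IsHardyLike (halfPlaneExt Q X) where
  continuousOn := continuousOn_halfPlaneExt_right Q X
  differentiableOn := differentiableOn_halfPlaneExt Q X
  decay := by
    obtain ⟨C, hC0, hC⟩ := norm_halfPlaneExt_le_inv_norm Q
    exact ⟨C, hC0, hC X⟩

lemma exists_halfPlaneExt_eq_of_mem_closure (Q : 𝓢(ℝ, ℂ)) {c : ℂ} (hc : c ≠ 0)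
    (h : c ∈ closure {z | ∃ (X : ℝ) (Ω : ℂ), 0 < Ω.im ∧ halfPlaneExt Q X Ω = z}) :
    ∃ (X : ℝ) (Ω : ℂ), 0 ≤ Ω.im ∧ halfPlaneExt Q X Ω = c := by
  obtain ⟨C₁, hC₁, h₁⟩ := norm_halfPlaneExt_le_inv_abs Q
  obtain ⟨C₂, hC₂, h₂⟩ := norm_halfPlaneExt_le_inv_norm Q
  set r : ℝ := ‖c‖ / 2
  have hr : 0 < r := half_pos (norm_pos_iff.2 hc)
  set K : Set (ℝ × ℂ) := (Metric.closedBall 0 (C₁ / r) ×ˢ Metric.closedBall 0 (C₂ / r)) ∩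
    {z | 0 ≤ z.2.im}
  have hK : IsCompact K :=
    ((isCompact_closedBall _ _).prod (isCompact_closedBall _ _)).inter_right
      (isClosed_le continuous_const (by fun_prop))
  set G : ℝ × ℂ → ℂ := fun z => halfPlaneExt Q z.1 z.2
  have hGK : IsCompact (G '' K) :=
    hK.image_of_continuousOn ((continuousOn_halfPlaneExt Q).mono Set.inter_subset_right)
  -- Values of modulus above `r = |c|/2` come from the compact set `K` by the two decay bounds; the
  -- remaining values stay away from `c`.
  have hsub : {z | ∃ (X : ℝ) (Ω : ℂ), 0 < Ω.im ∧ halfPlaneExt Q X Ω = z} ⊆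
      G '' K ∪ Metric.closedBall 0 r := by
    rintro _ ⟨X, Ω, hΩ, rfl⟩
    by_cases hle : ‖halfPlaneExt Q X Ω‖ ≤ r
    · right
      simpa using hle
    · left
      push Not at hle
      refine ⟨(X, Ω), ⟨⟨?_, ?_⟩, hΩ.le⟩, rfl⟩
      · rw [mem_closedBall_zero_iff, Real.norm_eq_abs, le_div_iff₀ hr]
        exact (mul_le_mul_of_nonneg_left hle.le (abs_nonneg _)).trans (h₁ X Ω hΩ.le)
      · rw [mem_closedBall_zero_iff, le_div_iff₀ hr]
        exact (mul_le_mul_of_nonneg_left hle.le (norm_nonneg _)).trans (h₂ X Ω hΩ.le)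
  rcases (closure_minimal hsub (hGK.isClosed.union Metric.isClosed_closedBall)) h with h | h
  · obtain ⟨⟨X, Ω⟩, hK, rfl⟩ := h
    exact ⟨X, Ω, hK.2, rfl⟩
  · rw [mem_closedBall_zero_iff] at h
    exact absurd h (not_le.2 (half_lt_self (norm_pos_iff.2 hc)))

/-- Recovers `X = 0`, where the kernel is zero and the Laplace transform carries no information, by
continuity in `X`. -/
lemma halfPlaneExt_mem_closure_left (Q : 𝓢(ℝ, ℂ)) (X : ℝ) {Ω : ℂ} (hΩ : 0 < Ω.im) :
    halfPlaneExt Q X Ω ∈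
      closure {z | ∃ (X : ℝ) (Ω : ℂ), X ≠ 0 ∧ 0 < Ω.im ∧ halfPlaneExt Q X Ω = z} := by
  have hcont : Continuous fun Y : ℝ => halfPlaneExt Q Y Ω :=
    (continuousOn_halfPlaneExt Q).comp_continuous (f := fun Y : ℝ => (Y, Ω)) (by fun_prop)
      fun _ => hΩ.le
  have hlim : Tendsto (fun Y : ℝ => halfPlaneExt Q Y Ω) (𝓝[{0}ᶜ] X) (𝓝 (halfPlaneExt Q X Ω)) :=
    (hcont.tendsto X).mono_left nhdsWithin_le_nhds
  have hne : (𝓝[{(0 : ℝ)}ᶜ] X).NeBot :=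
    mem_closure_iff_nhdsWithin_neBot.1 (dense_compl_singleton (0 : ℝ) X)
  refine mem_closure_of_tendsto hlim ?_
  filter_upwards [self_mem_nhdsWithin] with Y hY
  exact ⟨Y, Ω, hY, hΩ, rfl⟩

lemma isOpen_upperHalfPlane : IsOpen {Ω : ℂ | 0 < Ω.im} :=
  isOpen_lt continuous_const Complex.continuous_im

/-- The values on the closed half-plane are limits of values in the open half-plane that avoid
the boundary curve. -/
lemma mem_closure_values_off_curve (Q : 𝓢(ℝ, ℂ)) (X : ℝ) {c Ω : ℂ} (hc : c ≠ 0)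
    (hΩ : 0 ≤ Ω.im) (h : halfPlaneExt Q X Ω = c) :
    c ∈ closure {z | z ≠ 0 ∧ (∀ t : ℝ, halfPlaneExt Q X t ≠ z) ∧
      ∃ Ω : ℂ, 0 < Ω.im ∧ halfPlaneExt Q X Ω = z} := by
  set G := halfPlaneExt Q X
  have hG := isHardyLike_halfPlaneExt Q X
  have hU := isOpen_upperHalfPlane
  have hlim : Tendsto (fun ε : ℝ => G (Ω + ε * Complex.I)) (𝓝[>] 0) (𝓝 c) := by
    rw [← h]
    refine (hG.continuousOn Ω hΩ).tendsto.comp (tendsto_nhdsWithin_iff.2 ⟨?_, ?_⟩)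
    · have : Continuous fun ε : ℝ => Ω + ε * Complex.I := by fun_prop
      simpa using (this.tendsto 0).mono_left (nhdsWithin_le_nhds (s := Set.Ioi 0))
    · filter_upwards [self_mem_nhdsWithin] with ε (hε : 0 < ε)
      simpa using add_nonneg hΩ hε.le
  have hopen : ∀ s ⊆ {Ω : ℂ | 0 < Ω.im}, IsOpen s → IsOpen (G '' s) := by
    refine ((hG.differentiableOn.analyticOnNhd hU).is_constant_or_isOpen
      (convex_halfSpace_im_gt 0).isPreconnected).resolve_left ?_
    -- A constant value would equal `c`, by approach to `Ω` from above, and also 0, by decay along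
    -- the imaginary axis.
    rintro ⟨w, hw⟩
    have hwc : w = c := by
      refine tendsto_nhds_unique (tendsto_const_nhds.congr' ?_) hlim
      filter_upwards [self_mem_nhdsWithin] with ε (hε : 0 < ε)
      exact (hw _ (by simpa using add_pos_of_nonneg_of_pos hΩ hε)).symm
    have h0 : Tendsto (fun y : ℝ => G (y * Complex.I)) atTop (𝓝 0) := by
      refine hG.tendsto_zero ?_ ?_
      · filter_upwards [eventually_ge_atTop 0] with y hy
        simpa using hy
      · simpa using tendsto_abs_atTop_atTop
    have hw0 : w = 0 := by
      refine tendsto_nhds_unique (tendsto_const_nhds.congr' ?_) h0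
      filter_upwards [eventually_gt_atTop 0] with y hy
      exact (hw _ (by simpa using hy)).symm
    exact hc (hwc.symm.trans hw0)
  rw [mem_closure_iff]
  intro V hV hcV
  have hV' : IsOpen (V ∩ {0}ᶜ) := hV.inter isOpen_compl_singleton
  obtain ⟨ε, hε, hεV⟩ := ((eventually_mem_nhdsWithin (s := Set.Ioi (0 : ℝ))).and
    (hlim.eventually_mem (hV'.mem_nhds ⟨hcV, hc⟩))).exists
  have hε' : 0 < (Ω + ε * Complex.I).im := by
    simpa using add_pos_of_nonneg_of_pos hΩ hε
  -- The `C¹` image of a line has dense complement in the plane, so it cannot cover the nonempty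
  -- open set of values near `c`.
  have hdense : Dense (Set.range fun t : ℝ => G t)ᶜ :=
    (contDiff_halfPlaneExt_ofReal Q X).dense_compl_range_of_finrank_lt_finrank (by simp)
  obtain ⟨z, hz1, hz2⟩ := hdense.inter_open_nonempty _
    ((hopen _ subset_rfl hU).inter hV') ⟨_, ⟨_, hε', rfl⟩, hεV⟩
  refine ⟨z, hz1.2.1, hz1.2.2, fun t ht => hz2 ⟨t, ht⟩, ?_⟩
  obtain ⟨Ω', hΩ', rfl⟩ := hz1.1
  exact ⟨Ω', hΩ', rfl⟩

lemma enclosed_eq (P : 𝓢(ℝ, ℝ)) (hP : HasCompactSupport P) (X : ℝ) :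
    enclosed P X = {z | z ≠ 0 ∧ (∀ t : ℝ, halfPlaneExt (fourierReal P) X t ≠ z) ∧
      ∃ Ω : ℂ, 0 < Ω.im ∧ halfPlaneExt (fourierReal P) X Ω = z} := by
  have hs : signal (divDiff P X) = fun t : ℝ => halfPlaneExt (fourierReal P) X t :=
    funext fun t => signal_divDiff P hP X t
  have hG := isHardyLike_halfPlaneExt (fourierReal P) X
  ext z
  simp only [enclosed, curveSet, hs, Set.mem_ofPred_eq, Set.mem_union, Set.mem_range,
    Set.mem_singleton_iff, not_or, not_exists]
  constructor
  · rintro ⟨⟨hne, hz⟩, n, hn, hw⟩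
    exact ⟨hz, hne, hG.exists_eq_of_hasWindingNumber hz hne hn hw⟩
  · rintro ⟨hz, hne, Ω, hΩ, h⟩
    exact ⟨⟨hne, hz⟩, hG.exists_hasWindingNumber_ne_zero hz hne hΩ h⟩

lemma exists_hilbertOff_or_hilbert_iff (P : 𝓢(ℝ, ℝ)) (hP : HasCompactSupport P) (c : ℝ) :
    ((∃ (X : ℝ) (Ω : ℂ), Ω.im ≠ 0 ∧ hilbertOff (divDiff P X) Ω = c ∧
        hilbertOff (divDiff P X) (conj Ω) = c) ∨
      ∃ X Ω : ℝ, hilbert (divDiff P X) Ω = c ∧ divDiff P X Ω = 0) ↔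
    ∃ (X : ℝ) (Ω : ℂ), 0 ≤ Ω.im ∧ halfPlaneExt (fourierReal P) X Ω = c := by
  constructor
  · rintro (⟨X, Ω, hΩ, h1, h2⟩ | ⟨X, t, h1, h2⟩)
    · rcases lt_or_gt_of_ne hΩ with h | h
      · have hpos : 0 < (conj Ω).im := by simpa using h
        exact ⟨X, conj Ω, hpos.le, by rw [← hilbertOff_divDiff P hP X hpos, h2]⟩
      · exact ⟨X, Ω, h.le, by rw [← hilbertOff_divDiff P hP X h, h1]⟩
    · refine ⟨X, t, by simp, ?_⟩
      rw [← signal_divDiff P hP, signal, h1, h2]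
      simp
  · rintro ⟨X, Ω, hΩ, h⟩
    rcases hΩ.eq_or_lt with h0 | h0
    · right
      obtain ⟨t, rfl⟩ : ∃ t : ℝ, Ω = t := ⟨Ω.re, Complex.ext (by simp) (by simp [← h0])⟩
      rw [← signal_divDiff P hP, signal] at h
      refine ⟨X, t, ?_, ?_⟩
      · simpa using congrArg Complex.re h
      · simpa using congrArg Complex.im h
    · left
      rw [← hilbertOff_divDiff P hP X h0] at h
      refine ⟨X, Ω, h0.ne', h, ?_⟩
      rw [hilbertOff_conj, h, Complex.conj_ofReal]

/-- If the curve crosses the real axis only to the left of `c`, then the value `c` is not taken on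
the closed half-plane. -/
lemma halfPlaneExt_ne_of_hilbert_lt (P : 𝓢(ℝ, ℝ)) (hP : HasCompactSupport P) {c : ℝ} (hc : c ≠ 0)
    (X : ℝ) (h : ∀ t : ℝ, divDiff P X t = 0 → hilbert (divDiff P X) t < c) {Ω : ℂ}
    (hΩ : 0 ≤ Ω.im) : halfPlaneExt (fourierReal P) X Ω ≠ c := by
  set G := halfPlaneExt (fourierReal P) X
  have hG : IsHardyLike G := isHardyLike_halfPlaneExt (fourierReal P) X
  have hs : ∀ t : ℝ, G t = (hilbert (divDiff P X) t : ℂ) - Complex.I * (divDiff P X t : ℂ) :=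
    fun t => (signal_divDiff P hP X t).symm
  have hre : ∀ t : ℝ, (G t).re = hilbert (divDiff P X) t := fun t => by simp [hs]
  have him : ∀ t : ℝ, (G t).im = -divDiff P X t := fun t => by simp [hs]
  -- Outside the compact support the hypothesis applies, and there the Hilbert transform tends to 0,
  -- so `0 ≤ c`.
  have hcpos : 0 < c := by
    refine lt_of_le_of_ne ?_ hc.symm
    have hlim : Tendsto (fun t : ℝ => (G t).re) (cocompact ℝ) (𝓝 0) := by
      refine (Complex.continuous_re.tendsto 0).comp (hG.tendsto_zero (by simp) ?_)
      simpa only [Complex.norm_real] using tendsto_norm_cocompact_atTop (E := ℝ)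
    refine le_of_tendsto hlim ?_
    have hz : ∀ᶠ t in cocompact ℝ, divDiff P X t = 0 := by
      have := hasCompactSupport_iff_eventuallyEq.1 (hasCompactSupport_divDiff hP X)
      rwa [coclosedCompact_eq_cocompact] at this
    filter_upwards [hz] with t ht
    rw [hre]
    exact (h t ht).le
  have hslit : ∀ t : ℝ, (c : ℂ) - G t ∈ Complex.slitPlane := fun t => by
    rw [Complex.mem_slitPlane_iff]
    by_cases h0 : divDiff P X t = 0
    · left
      simpa [hre] using h t h0
    · right
      simpa [him] using h0
  -- As `c - G` stays in the slit plane, its principal logarithm is continuous and has the limit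
  -- `log c` at both ends; adding `πi` gives a logarithm of `G - c` with no net increment.
  have hw : HasWindingNumber (fun t : ℝ => G t) c 0 := by
    refine ⟨fun t => Complex.log (c - G t) + Real.pi * Complex.I, ?_, fun t => ?_,
      Complex.log c + Real.pi * Complex.I, ?_, ?_⟩
    · have hGc : Continuous fun t : ℝ => G t :=
        (contDiff_halfPlaneExt_ofReal (fourierReal P) X).continuous
      exact ((continuous_const.sub hGc).clog hslit).add continuous_const
    · rw [Complex.exp_add, Complex.exp_log (Complex.slitPlane_ne_zero (hslit t)),
        Complex.exp_pi_mul_I]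
      ring
    · have := (tendsto_const_nhds (x := (c : ℂ))).sub hG.tendsto_atBot
      rw [sub_zero] at this
      exact (this.clog (by simpa using hcpos)).add_const _
    · have := (tendsto_const_nhds (x := (c : ℂ))).sub hG.tendsto_atTop
      rw [sub_zero] at this
      simpa using (this.clog (by simpa using hcpos)).add_const (Real.pi * Complex.I)
  rcases hΩ.eq_or_lt with h0 | h0
  · obtain ⟨t, rfl⟩ : ∃ t : ℝ, Ω = t := ⟨Ω.re, Complex.ext (by simp) (by simp [← h0])⟩
    exact fun heq => Complex.slitPlane_ne_zero (hslit t) (by rw [heq, sub_self])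
  · exact hG.ne_of_hasWindingNumber_zero hw h0

end Alber

/-- The first conjunct records that the principal values defining `H[D_X P]` on the real line
exist. The distance in (C) is the extended one, so that the empty set is at distance `∞`. -/
theorem theorem3p5 (P : 𝓢(ℝ, ℝ)) (hP : HasCompactSupport P) (p q : ℝ) (hp : p ≠ 0) (hq : q ≠ 0) :
    (∀ X t : ℝ, Tendsto (Alber.hilbertTrunc (Alber.divDiff P X) t) (𝓝[>] 0)
      (𝓝 (Alber.hilbert (Alber.divDiff P X) t))) ∧
    List.TFAE [
      Alber.penroseInf P p q = 0,
      ¬ Alber.IsStable P p q,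
      (∃ (X : ℝ) (Ω : ℂ), Ω.im ≠ 0 ∧
          Alber.hilbertOff (Alber.divDiff P X) Ω = ((4 * Real.pi * p / q : ℝ) : ℂ) ∧
          Alber.hilbertOff (Alber.divDiff P X) (conj Ω) = ((4 * Real.pi * p / q : ℝ) : ℂ)) ∨
        (∃ X Ω : ℝ, Alber.hilbert (Alber.divDiff P X) Ω = 4 * Real.pi * p / q ∧
          Alber.divDiff P X Ω = 0),
      Metric.infEDist ((4 * Real.pi * p / q : ℝ) : ℂ) (Alber.enclosedClosure P) = 0] ∧
    ((∀ X t : ℝ, Alber.divDiff P X t = 0 →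
        Alber.hilbert (Alber.divDiff P X) t < 4 * Real.pi * p / q) →
      Alber.IsStable P p q) := by
  set c : ℝ := 4 * Real.pi * p / q with hc
  have hc0 : c ≠ 0 := by
    have := Real.pi_ne_zero
    positivity
  have hc0' : (c : ℂ) ≠ 0 := by exact_mod_cast hc0
  have hAB : Alber.penroseInf P p q = 0 →
      ∃ (X : ℝ) (Ω : ℂ), 0 ≤ Ω.im ∧ Alber.halfPlaneExt (Alber.fourierReal P) X Ω = c := fun h =>
    Alber.exists_halfPlaneExt_eq_of_mem_closure _ hc0' <|
      closure_mono (by rintro z ⟨X, Ω, -, hΩ, hz⟩; exact ⟨X, Ω, hΩ, hz⟩)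
        ((Alber.penroseInf_eq_zero_iff P hp hq).1 h)
  refine ⟨fun X t => ?_, ?_, fun h => ?_⟩
  · have hu := Alber.contDiff_divDiff P X
    have hs := Alber.hasCompactSupport_divDiff hP X
    rw [Alber.hilbert_eq hu hs]
    exact Alber.tendsto_hilbertTrunc hu hs t
  · rw [Alber.exists_hilbertOff_or_hilbert_iff P hP c]
    tfae_have 1 ↔ 2 := (Alber.not_isStable_iff P p q).symm
    tfae_have 1 → 3 := hAB
    tfae_have 3 → 4 := by
      rintro ⟨X, Ω, hΩ, h⟩
      refine Metric.infEDist_zero_of_mem ?_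
      refine closure_mono (Set.subset_iUnion (Alber.enclosed P) X) ?_
      rw [Alber.enclosed_eq P hP]
      exact Alber.mem_closure_values_off_curve _ X hc0' hΩ h
    tfae_have 4 → 1 := by
      intro h
      rw [Alber.enclosedClosure, Metric.infEDist_closure, ← Metric.mem_closure_iff_infEDist_zero] at h
      rw [Alber.penroseInf_eq_zero_iff P hp hq]
      refine closure_minimal (Set.iUnion_subset fun X z hz => ?_) isClosed_closure h
      rw [Alber.enclosed_eq P hP] at hz
      obtain ⟨-, -, Ω, hΩ, rfl⟩ := hz
      exact Alber.halfPlaneExt_mem_closure_left _ X hΩ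
    tfae_finish
  · by_contra hns
    obtain ⟨X, Ω, hΩ, hG⟩ := hAB ((Alber.not_isStable_iff P p q).1 hns)
    exact Alber.halfPlaneExt_ne_of_hilbert_lt P hP hc0 X (h X) hΩ hG
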